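/- **Setting.** Let $\Sigma$ be a finite set of events, $\checkmark\notin\Sigma$, and let $\Sigma^{*\checkmark}$ be the set of finite sequences over $\Sigma$ that may end with $\checkmark$. CSP terms are generated by $$P ::= \mathrm{STOP}\mid a\to P\mid \mathrm{SKIP}\mid P\sqcap P\mid P\,\square\,P\mid P\parallel_A P\mid P;P\mid P\setminus A\mid P[R]\mid X\mid \mu X.P\mid \mathrm{DIV}$$ with $a\in\Sigma$, $A\subseteq\Sigma$, $R\subseteq\Sigma\times\Sigma$ and $X$ a process variable. A term is *closed* if it has no free variable; closed terms are called processes. **Semantics.** Let $\mathcal T$ be the set of pairs $(T,D)$ of subsets of $\Sigma^{*\checkmark}$ such that $D\subseteq T$; $s\frown\langle\checkmark\rangle\in D$ implies $s\in D$; $T$ is non-empty and prefix-closed; and $s\in D\cap\Sigma^*$, $t\in\Sigma^{*\checkmark}$ imply $s\frown t\in D$. Order $\mathcal T$ by $(T_1,D_1)\sqsubseteq(T_2,D_2)$ iff $T_2\subseteq T_1$ and $D_2\subseteq D_1$; this is a complete lattice. A term $P$ denotes a monotone map from assignments $\rho$ of elements of $\mathcal T$ to the variables into $\mathcal T$; write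 $(T_P,D_P)$ for its value at $\rho$. A variable $X$ denotes $\rho(X)$, and $\mu X.P$ denotes the least fixed point of $x\mapsto P(\rho[X:=x])$. In the other cases $r$ ranges over $\Sigma^{*\checkmark}$ and the value is as follows. * $\mathrm{STOP}$: $(\{\langle\rangle\},\emptyset)$. $\mathrm{SKIP}$: $(\{\langle\rangle,\langle\checkmark\rangle\},\emptyset)$. $\mathrm{DIV}$: $(\Sigma^{*\checkmark},\Sigma^{*\checkmark})$. * $a\to P$: $(\{\langle\rangle\}\cup\{\langle a\rangle\frown t: t\in T_P\},\ \{\langle a\rangle\frown t:t\in D_P\})$. $P\sqcap Q$ and $P\,\square\,Q$: $(T_P\cup T_Q,\ D_P\cup D_Q)$. * $P;Q$: $D=D_P\cup\{t\frown s: t\frown\langle\checkmark\rangle\in T_P,\ s\in D_Q\}$ and $T=(T_P\cap\Sigma^*)\cup\{t\frown s: t\frown\langle\checkmark\rangle\in T_P,\ s\in T_Q\}\cup D$. * $P\setminus A$ (where $\upharpoonright$ deletes the events of $A$ and keeps $\checkmark$): $D=\{(t\upharpoonright)\frown r: t\in D_P\cap\Sigma^*\}\cup\{(u\upharpoonright)\frown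 r: u\in\Sigma^\omega,\ u\upharpoonright\text{ finite, all finite prefixes of }u\text{ in }T_P\}$ and $T=\{t\upharpoonright\,: t\in T_P\}\cup D$. * $P[R]$ (with $R$ lifted element-wise to traces and $\checkmark\,R\,\checkmark$): $D=\{t\frown r:\exists s\in D_P\cap\Sigma^*,\ s\,R\,t\}$ and $T=\{t:\exists s\in T_P,\ s\,R\,t\}\cup D$. * $P\parallel_A Q$, with $s\parallel_A t$ the set of interleavings of $s$ and $t$ in which exactly the members of $A\cup\{\checkmark\}$ are synchronised: $D=\{u\frown r: s\in T_P,\ t\in T_Q,\ u\in (s\parallel_A t)\cap\Sigma^*,\ s\in D_P\text{ or }t\in D_Q\}$ and $T=\bigcup_{s\in T_P,\,t\in T_Q}(s\parallel_A t)\cup D$. **The sets $N_X,C_X,F,G$.** Write $R(U)=\{y:\exists x\in U,\ x\,R\,y\}$ and $\mathcal P=\mathcal P(\Sigma)$. For every term $P$ and variable $X$ define $N_X(P),C_X(P),F(P)\subseteq\mathcal P\times\mathcal P$ and $G(P)\subseteq\mathcal P$ by simultaneous recursion on $P$. $N_X(P)=\mathcal P\times\mathcal P$ if $X$ is not free in $P$;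 otherwise * $N_X(a\to P)=N_X(P)$; $N_X(P_1\oplus P_2)=N_X(P_1)\cap N_X(P_2)$ for $\oplus\in\{\sqcap,\square,;,\parallel_A\}$; * $N_X(P\setminus A)=\{(U,V):\exists V',\ (U,V')\in N_X(P),\ V'\cap A=\emptyset,\ V'\subseteq V\}$; $N_X(P[R])=\{(U,V):\exists V',\ (U,V')\in N_X(P),\ R(V')\subseteq V\}$; * $N_X(X)=\{(U,V):U\subseteq V\}$; $N_X(\mu Y.P)=\{(U,V):\exists U',V',\ (U',V')\in N_X(P),\ (V',V')\in N_Y(P),\ U\subseteq U',\ V'\subseteq V\}$ for $Y\ne X$. $C_X(P)=\mathcal P\times\mathcal P$ if $X$ is not free in $P$; otherwise * $C_X(a\to P)=C_X(P)\cup\{(U,V)\in N_X(P):a\in V\}$; $C_X(P_1\oplus P_2)=C_X(P_1)\cap C_X(P_2)$ for $\oplus\in\{\sqcap,\square,\parallel_A\}$; * $C_X(P_1;P_2)=C_X(P_1)\cap\bigl(C_X(P_2)\cup\{(U,V)\in N_X(P_2):V\in G(P_1)\}\bigr)$; * $C_X(P\setminus A)=\{(U,V):\exists V',\ (U,V')\in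 C_X(P),\ V'\cap A=\emptyset,\ V'\subseteq V\}$; $C_X(P[R])=\{(U,V):\exists V',\ (U,V')\in C_X(P),\ R(V')\subseteq V\}$; * $C_X(X)=\emptyset$; $C_X(\mu Y.P)=\{(U,V):\exists U',V',\ (U',V')\in C_X(P),\ (V',V')\in N_Y(P),\ U\subseteq U',\ V'\subseteq V\}$ for $Y\neq X$. Fair sets: * $F(\mathrm{STOP})=F(\mathrm{SKIP})=\mathcal P\times\mathcal P$; $F(\mathrm{DIV})=\emptyset$; $F(a\to P)=F(P)$; $F(P_1\oplus P_2)=F(P_1)\cap F(P_2)$ for $\oplus\in\{\sqcap,\square,;\}$; * $F(P_1\parallel_A P_2)=(F(P_1)\cap F(P_2))\cup\{(U_1\cap U_2,V_1):(U_1,V_1)\in F(P_1),(U_2,A)\in F(P_2)\}\cup\{(U_1\cap U_2,V_2):(U_2,V_2)\in F(P_2),(U_1,A)\in F(P_1)\}$; * $F(P\setminus A)=\{(U,V):\exists V',\ (U,V')\in F(P),\ V'\cap A=\emptyset,\ V'\subseteq V\}$; $F(P[R])=\{(U,V):\exists V',\ (U,V')\in F(P),\ R(V')\subseteq V\}$;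 $F(X)=\{(U,V):U\subseteq V\}$; * $F(\mu X.P)$ is the set of $(U,V)$ for which there is $W$ with $(W,W)\in C_X(P)\cap F(P)$ and $W\subseteq V$, and moreover, when $\mu X.P$ is not closed, $U\subseteq W$. Guard sets: * $G(\mathrm{STOP})=\mathcal P$; $G(\mathrm{SKIP})=G(\mathrm{DIV})=G(X)=\emptyset$; $G(a\to P)=G(P)\cup\{V:a\in V\}$; $G(\mu X.P)=G(P)$; $G(P_1\sqcap P_2)=G(P_1\,\square\,P_2)=G(P_1)\cap G(P_2)$; * $G(P_1;P_2)=G(P_1)\cup G(P_2)$ if $P_1$ is closed and $F(P_1)\ne\emptyset$, and $G(P_1)$ otherwise; * $G(P_1\parallel_A P_2)=G(P_1)\cup G(P_2)$ if $P_1,P_2$ are closed and $F(P_1)\neq\emptyset\neq F(P_2)$, and $G(P_1)\cap G(P_2)$ otherwise; * $G(P\setminus A)=\{V:\exists V'\in G(P),\ V'\cap A=\emptyset,\ V'\subseteq V\}$ if $P$ is closed and $(\emptyset,\Sigma\setminus A)\in F(P)$, and $\emptyset$ otherwise; * $G(P[R])=\{V:\exists V'\in G(P),\ R(V')\subseteq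 V\}$. **Proposition.** Let $P$ be a CSP term and $V\in G(P)$. Then, with any processes substituted for the free variables of $P$ (in particular $\mathrm{DIV}$), $P$ must communicate an event of $V$ before it can perform $\checkmark$. That is, for every assignment $\rho$ of elements of $\mathcal T$ to the variables, if $s\in\Sigma^*$ and $s\frown\langle\checkmark\rangle\in T_P$ (the trace set of $P$ at $\rho$), then some event of $V$ occurs in $s$; and the same holds for the trace set of the term obtained from $P$ by substituting arbitrary closed terms for its free variables. -/

import Mathlib

namespace CSP

/-! ### Terms -/

/-- CSP terms over the alphabet `E` (the events other than `✓`) with process variables in `Var`. -/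
inductive Term (E : Type*) (Var : Type*) where
  | STOP : Term E Var
  | pre (a : E) (P : Term E Var) : Term E Var
  | SKIP : Term E Var
  | intChoice (P Q : Term E Var) : Term E Var
  | extChoice (P Q : Term E Var) : Term E Var
  | par (A : Set E) (P Q : Term E Var) : Term E Var
  | seq (P Q : Term E Var) : Term E Var
  | hide (P : Term E Var) (A : Set E) : Term E Var
  | rename (P : Term E Var) (R : E → E → Prop) : Term E Var
  | var (X : Var) : Term E Var
  | mu (X : Var) (P : Term E Var) : Term E Var
  | DIV : Term E Var

section
variable {E : Type*} {Var : Type*}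

/-- The free variables of a term. -/
def Term.fv : Term E Var → Set Var
  | .STOP => ∅
  | .pre _ P => P.fv
  | .SKIP => ∅
  | .intChoice P Q => P.fv ∪ Q.fv
  | .extChoice P Q => P.fv ∪ Q.fv
  | .par _ P Q => P.fv ∪ Q.fv
  | .seq P Q => P.fv ∪ Q.fv
  | .hide P _ => P.fv
  | .rename P _ => P.fv
  | .var X => {X}
  | .mu X P => P.fv \ {X}
  | .DIV => ∅

/-- Closed terms; these are the processes of the syntax. -/
def Term.IsClosed (P : Term E Var) : Prop := P.fv = ∅

/-- Simultaneous substitution of `σ X` for every free occurrence of each variable `X`.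
It is only used with closed `σ X`, so that no variable can be captured. -/
def Term.subst [DecidableEq Var] : Term E Var → (Var → Term E Var) → Term E Var
  | .STOP, _ => .STOP
  | .pre a P, σ => .pre a (P.subst σ)
  | .SKIP, _ => .SKIP
  | .intChoice P Q, σ => .intChoice (P.subst σ) (Q.subst σ)
  | .extChoice P Q, σ => .extChoice (P.subst σ) (Q.subst σ)
  | .par A P Q, σ => .par A (P.subst σ) (Q.subst σ)
  | .seq P Q, σ => .seq (P.subst σ) (Q.subst σ)
  | .hide P A, σ => .hide (P.subst σ) A
  | .rename P R, σ => .rename (P.subst σ) R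
  | .var X, σ => σ X
  | .mu X P, σ => .mu X (P.subst (Function.update σ X (.var X)))
  | .DIV, _ => .DIV

/-! ### Traces -/

/-- A finite trace that may end with `✓`: `⟨s, false⟩` is the `✓`-free trace `s`, and
`⟨s, true⟩` is the trace `s` followed by `✓`. -/
@[ext] structure Trace (E : Type*) where
  events : List E
  tick : Bool

/-- The concatenation of a `✓`-free trace with a trace. -/
def Trace.cat (s : List E) (t : Trace E) : Trace E := ⟨s ++ t.events, t.tick⟩

/-- `s` is a (not necessarily proper) initial segment of `t`. -/
def Trace.Initial (s t : Trace E) : Prop :=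
  s = t ∨ (s.tick = false ∧ s.events <+: t.events)

open Classical in
/-- Deletion of the events of `A`. -/
noncomputable def hideEvents (A : Set E) (s : List E) : List E := s.filter (fun e => e ∉ A)

/-- The first `n` events of an infinite sequence of events. -/
def firstEvents (u : ℕ → E) (n : ℕ) : List E := (List.range n).map u

/-- `Merge A s t u`: the `✓`-free trace `u` is an interleaving of `s` and `t` in which exactly
the events of `A` are synchronised. -/
inductive Merge (A : Set E) : List E → List E → List E → Prop
  | nil : Merge A [] [] []
  | left {b : E} {s t u : List E} : b ∉ A → Merge A s t u → Merge A (b :: s) t (b :: u)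
  | right {b : E} {s t u : List E} : b ∉ A → Merge A s t u → Merge A s (b :: t) (b :: u)
  | sync {a : E} {s t u : List E} : a ∈ A → Merge A s t u → Merge A (a :: s) (a :: t) (a :: u)

/-- Interleaving of traces synchronised on `A` and on `✓` (distributed termination). -/
def Trace.Merge (A : Set E) (s t u : Trace E) : Prop :=
  CSP.Merge A s.events t.events u.events ∧ s.tick = u.tick ∧ t.tick = u.tick

theorem prefix_append_cases {s x r : List E} (h : s <+: x ++ r) :
    s <+: x ∨ ∃ m, s = x ++ m ∧ m <+: r := by
  induction x generalizing s with
  | nil => exact Or.inr ⟨s, rfl, h⟩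
  | cons c x ih =>
    cases s with
    | nil => exact Or.inl List.nil_prefix
    | cons d s =>
      rw [List.cons_append, List.cons_prefix_cons] at h
      obtain ⟨rfl, h⟩ := h
      rcases ih h with h | ⟨m, rfl, hm⟩
      · exact Or.inl (List.cons_prefix_cons.2 ⟨rfl, h⟩)
      · exact Or.inr ⟨m, rfl, hm⟩

theorem Merge.exists_of_initial {A : Set E} {s t u v : List E} (h : Merge A s t u)
    (hv : v <+: u) : ∃ s' t', s' <+: s ∧ t' <+: t ∧ Merge A s' t' v := by
  induction h generalizing v with
  | nil => exact ⟨[], [], List.nil_prefix, List.nil_prefix, by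
    rw [List.prefix_nil.1 hv]; exact .nil⟩
  | left hb _ ih =>
    cases v with
    | nil => exact ⟨[], [], List.nil_prefix, List.nil_prefix, .nil⟩
    | cons c v =>
      rw [List.cons_prefix_cons] at hv
      obtain ⟨rfl, hv⟩ := hv
      obtain ⟨s', t', hs, ht, h⟩ := ih hv
      exact ⟨c :: s', t', List.cons_prefix_cons.2 ⟨rfl, hs⟩, ht, .left hb h⟩
  | right hb _ ih =>
    cases v with
    | nil => exact ⟨[], [], List.nil_prefix, List.nil_prefix, .nil⟩
    | cons c v =>
      rw [List.cons_prefix_cons] at hv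
      obtain ⟨rfl, hv⟩ := hv
      obtain ⟨s', t', hs, ht, h⟩ := ih hv
      exact ⟨s', c :: t', hs, List.cons_prefix_cons.2 ⟨rfl, ht⟩, .right hb h⟩
  | sync hb _ ih =>
    cases v with
    | nil => exact ⟨[], [], List.nil_prefix, List.nil_prefix, .nil⟩
    | cons c v =>
      rw [List.cons_prefix_cons] at hv
      obtain ⟨rfl, hv⟩ := hv
      obtain ⟨s', t', hs, ht, h⟩ := ih hv
      exact ⟨c :: s', c :: t', List.cons_prefix_cons.2 ⟨rfl, hs⟩,
        List.cons_prefix_cons.2 ⟨rfl, ht⟩, .sync hb h⟩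

theorem forall₂_initial {R : E → E → Prop} {s t v : List E} (h : List.Forall₂ R s t)
    (hv : v <+: t) : ∃ s', s' <+: s ∧ List.Forall₂ R s' v := by
  refine ⟨s.take v.length, List.take_prefix _ _, ?_⟩
  rw [List.prefix_iff_eq_take.1 hv, List.length_take_of_le hv.length_le]
  exact List.forall₂_take _ h

/-! ### The semantic domain -/

/-- The traces/divergences model: pairs of a set `T` of traces (closed under divergence, the
`traces⊥` of a process) and a set `D` of divergences. -/
@[ext] structure Proc (E : Type*) where
  T : Set (Trace E)
  D : Set (Trace E)
  div_subset : D ⊆ T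
  div_of_tick : ∀ s : List E, (⟨s, true⟩ : Trace E) ∈ D → (⟨s, false⟩ : Trace E) ∈ D
  nonempty : T.Nonempty
  closed : ∀ s t : Trace E, t ∈ T → s.Initial t → s ∈ T
  div_cat : ∀ (s : List E) (t : Trace E), (⟨s, false⟩ : Trace E) ∈ D → Trace.cat s t ∈ D

theorem Proc.nil_mem (p : Proc E) : (⟨[], false⟩ : Trace E) ∈ p.T := by
  obtain ⟨t, ht⟩ := p.nonempty
  exact p.closed _ t ht (Or.inr ⟨rfl, List.nil_prefix⟩)

/-- `p ≤ q` is the refinement order `p ⊑ q`: reverse inclusion in both components. -/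
instance : PartialOrder (Proc E) where
  le p q := q.T ⊆ p.T ∧ q.D ⊆ p.D
  le_refl _ := ⟨subset_rfl, subset_rfl⟩
  le_trans _ _ _ h₁ h₂ := ⟨h₂.1.trans h₁.1, h₂.2.trans h₁.2⟩
  le_antisymm _ _ h₁ h₂ := Proc.ext (h₂.1.antisymm h₁.1) (h₂.2.antisymm h₁.2)

/-- Greatest lower bounds are unions. The trace `⟨⟩`, a member of all trace sets, is added for
the sake of the empty family only. -/
instance : InfSet (Proc E) where
  sInf S :=
    { T := {⟨[], false⟩} ∪ ⋃ p ∈ S, p.T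
      D := ⋃ p ∈ S, p.D
      div_subset := by
        intro t ht
        simp only [Set.mem_iUnion] at ht
        obtain ⟨p, hp, h⟩ := ht
        exact Or.inr (Set.mem_biUnion hp (p.div_subset h))
      div_of_tick := by
        intro s hs
        simp only [Set.mem_iUnion] at hs ⊢
        obtain ⟨p, hp, h⟩ := hs
        exact ⟨p, hp, p.div_of_tick s h⟩
      nonempty := ⟨_, Or.inl rfl⟩
      closed := by
        rintro s t (ht | ht) hst
        · subst ht
          rcases hst with rfl | ⟨h1, h2⟩
          · exact Or.inl rfl
          · exact Or.inl (Trace.ext (List.prefix_nil.1 h2) h1)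
        · simp only [Set.mem_iUnion] at ht
          obtain ⟨p, hp, h⟩ := ht
          exact Or.inr (Set.mem_biUnion hp (p.closed s t h hst))
      div_cat := by
        intro s t hs
        simp only [Set.mem_iUnion] at hs ⊢
        obtain ⟨p, hp, h⟩ := hs
        exact ⟨p, hp, p.div_cat s t h⟩ }

theorem Proc.isGLB_sInf (S : Set (Proc E)) : IsGLB S (sInf S) := by
  constructor
  · intro p hp
    exact ⟨fun t ht => Or.inr (Set.mem_biUnion hp ht), fun t ht => Set.mem_biUnion hp ht⟩
  · intro q hq
    refine ⟨?_, ?_⟩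
    · rintro t (ht | ht)
      · subst ht
        exact q.nil_mem
      · simp only [Set.mem_iUnion] at ht
        obtain ⟨p, hp, h⟩ := ht
        exact (hq hp).1 h
    · intro t ht
      obtain ⟨p, hp, h⟩ := Set.mem_iUnion₂.1 ht
      exact (hq hp).2 h

noncomputable instance : CompleteLattice (Proc E) := completeLatticeOfInf _ Proc.isGLB_sInf

/-! ### The operators -/

namespace Proc

def STOP : Proc E where
  T := {⟨[], false⟩}
  D := ∅
  div_subset := Set.empty_subset _
  div_of_tick := by simp
  nonempty := ⟨_, rfl⟩
  closed := by
    rintro s t rfl (rfl | ⟨h1, h2⟩)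
    · rfl
    · exact Trace.ext (List.prefix_nil.1 h2) h1
  div_cat := by simp

def SKIP : Proc E where
  T := {⟨[], false⟩, ⟨[], true⟩}
  D := ∅
  div_subset := Set.empty_subset _
  div_of_tick := by simp
  nonempty := ⟨_, Or.inl rfl⟩
  closed := by
    rintro s t (rfl | rfl) (rfl | ⟨h1, h2⟩)
    · exact Or.inl rfl
    · exact Or.inl (Trace.ext (List.prefix_nil.1 h2) h1)
    · exact Or.inr rfl
    · exact Or.inl (Trace.ext (List.prefix_nil.1 h2) h1)
  div_cat := by simp

def DIV : Proc E where
  T := Set.univ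
  D := Set.univ
  div_subset := subset_rfl
  div_of_tick := by simp
  nonempty := ⟨⟨[], false⟩, trivial⟩
  closed := by simp
  div_cat := by simp

def pre (a : E) (p : Proc E) : Proc E where
  T := {⟨[], false⟩} ∪ {t | ∃ s ∈ p.T, t = Trace.cat [a] s}
  D := {t | ∃ s ∈ p.D, t = Trace.cat [a] s}
  div_subset := by
    rintro _ ⟨s, hs, rfl⟩
    exact Or.inr ⟨s, p.div_subset hs, rfl⟩
  div_of_tick := by
    rintro s ⟨⟨r, b⟩, hr, h⟩
    simp only [Trace.cat, Trace.mk.injEq] at h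
    obtain ⟨rfl, rfl⟩ := h
    exact ⟨⟨r, false⟩, p.div_of_tick r hr, rfl⟩
  nonempty := ⟨_, Or.inl rfl⟩
  closed := by
    rintro ⟨s, b⟩ t ht (rfl | ⟨h1, h2⟩)
    · exact ht
    · simp only at h1 h2
      subst h1
      rcases ht with rfl | ⟨r, hr, rfl⟩
      · exact Or.inl (Trace.ext (List.prefix_nil.1 h2) rfl)
      · cases s with
        | nil => exact Or.inl rfl
        | cons c s =>
          simp only [Trace.cat, List.singleton_append, List.cons_prefix_cons] at h2
          obtain ⟨rfl, h2⟩ := h2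
          exact Or.inr ⟨⟨s, false⟩, p.closed _ r hr (Or.inr ⟨rfl, h2⟩), rfl⟩
  div_cat := by
    rintro s t ⟨⟨r, b⟩, hr, h⟩
    simp only [Trace.cat, Trace.mk.injEq] at h
    obtain ⟨rfl, rfl⟩ := h
    exact ⟨_, p.div_cat r t hr, by simp [Trace.cat]⟩

/-- Both choice operators. -/
def choice (p q : Proc E) : Proc E where
  T := p.T ∪ q.T
  D := p.D ∪ q.D
  div_subset := Set.union_subset_union p.div_subset q.div_subset
  div_of_tick s := Or.imp (p.div_of_tick s) (q.div_of_tick s)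
  nonempty := p.nonempty.inl
  closed s t ht hst := ht.imp (fun h => p.closed s t h hst) (fun h => q.closed s t h hst)
  div_cat s t := Or.imp (p.div_cat s t) (q.div_cat s t)

/-- Divergences of a sequential composition. -/
def seqD (p q : Proc E) : Set (Trace E) :=
  p.D ∪ {t | ∃ s : List E, ⟨s, true⟩ ∈ p.T ∧ ∃ r ∈ q.D, t = Trace.cat s r}

def seq (p q : Proc E) : Proc E where
  T := {t | t ∈ p.T ∧ t.tick = false} ∪
    {t | ∃ s : List E, ⟨s, true⟩ ∈ p.T ∧ ∃ r ∈ q.T, t = Trace.cat s r} ∪ seqD p q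
  D := seqD p q
  div_subset := Set.subset_union_right
  div_of_tick := by
    rintro s (h | ⟨r, hr, ⟨v, b⟩, hv, h⟩)
    · exact Or.inl (p.div_of_tick s h)
    · simp only [Trace.cat, Trace.mk.injEq] at h
      obtain ⟨rfl, rfl⟩ := h
      exact Or.inr ⟨r, hr, ⟨v, false⟩, q.div_of_tick v hv, rfl⟩
  nonempty := ⟨_, Or.inl (Or.inl ⟨p.nil_mem, rfl⟩)⟩
  closed := by
    rintro ⟨s, b⟩ t ht (rfl | ⟨h1, h2⟩)
    · exact ht
    simp only at h1 h2
    subst h1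
    have key : ∀ (x : List E) (r : Trace E), ⟨x, true⟩ ∈ p.T → r ∈ q.T →
        s <+: x ++ r.events → (⟨s, false⟩ ∈ p.T ∧ (⟨s, false⟩ : Trace E).tick = false) ∨
          ∃ y : List E, ⟨y, true⟩ ∈ p.T ∧ ∃ r ∈ q.T, (⟨s, false⟩ : Trace E) = Trace.cat y r := by
      intro x r hx hr h
      rcases prefix_append_cases h with h | ⟨m, rfl, hm⟩
      · exact Or.inl ⟨p.closed _ _ hx (Or.inr ⟨rfl, h⟩), rfl⟩
      · exact Or.inr ⟨x, hx, ⟨m, false⟩, q.closed _ r hr (Or.inr ⟨rfl, hm⟩), rfl⟩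
    rcases ht with (⟨ht, -⟩ | ⟨x, hx, r, hr, rfl⟩) | (ht | ⟨x, hx, r, hr, rfl⟩)
    · exact Or.inl (Or.inl ⟨p.closed _ t ht (Or.inr ⟨rfl, h2⟩), rfl⟩)
    · exact Or.inl (key x r hx hr h2)
    · exact Or.inl (Or.inl ⟨p.closed _ t (p.div_subset ht) (Or.inr ⟨rfl, h2⟩), rfl⟩)
    · exact Or.inl (key x r hx (q.div_subset hr) h2)
  div_cat := by
    rintro s t (h | ⟨r, hr, ⟨v, b⟩, hv, h⟩)
    · exact Or.inl (p.div_cat s t h)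
    · simp only [Trace.cat, Trace.mk.injEq] at h
      obtain ⟨rfl, rfl⟩ := h
      exact Or.inr ⟨r, hr, _, q.div_cat v t hv, by simp [Trace.cat]⟩

/-- The process with divergences `b ⌢ r`, for `b ∈ B` and `r` an arbitrary trace, and with the
traces `T₀` in addition to its divergences. -/
def extend (T₀ : Set (Trace E)) (B : Set (List E)) (nil : ⟨[], false⟩ ∈ T₀)
    (init : ∀ (s : List E) (t : Trace E), t ∈ T₀ → s <+: t.events → ⟨s, false⟩ ∈ T₀)
    (sub : ∀ s ∈ B, ⟨s, false⟩ ∈ T₀) : Proc E where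
  T := T₀ ∪ {t | ∃ s ∈ B, ∃ r, t = Trace.cat s r}
  D := {t | ∃ s ∈ B, ∃ r, t = Trace.cat s r}
  div_subset := Set.subset_union_right
  div_of_tick := by
    rintro s ⟨x, hx, ⟨r, b⟩, h⟩
    simp only [Trace.cat, Trace.mk.injEq] at h
    obtain ⟨rfl, rfl⟩ := h
    exact ⟨x, hx, ⟨r, false⟩, rfl⟩
  nonempty := ⟨_, Or.inl nil⟩
  closed := by
    rintro ⟨s, b⟩ t ht (rfl | ⟨h1, h2⟩)
    · exact ht
    simp only at h1 h2
    subst h1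
    rcases ht with ht | ⟨x, hx, r, rfl⟩
    · exact Or.inl (init s t ht h2)
    · rcases prefix_append_cases h2 with h | ⟨m, rfl, -⟩
      · exact Or.inl (init s _ (sub x hx) h)
      · exact Or.inr ⟨x, hx, ⟨m, false⟩, rfl⟩
  div_cat := by
    rintro s t ⟨x, hx, ⟨r, b⟩, h⟩
    simp only [Trace.cat, Trace.mk.injEq] at h
    obtain ⟨rfl, rfl⟩ := h
    exact ⟨x, hx, Trace.cat r t, by simp [Trace.cat]⟩

/-- Divergence of `p \ A` arises from a divergence of `p`, or from an infinite sequence `u` of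
events all of whose initial segments are traces of `p` and which has only events of `A` from
some position `n` on. -/
noncomputable def hide (p : Proc E) (A : Set E) : Proc E :=
  extend
    {t | ∃ s ∈ p.T, t = ⟨hideEvents A s.events, s.tick⟩}
    ({t | ∃ s : List E, ⟨s, false⟩ ∈ p.D ∧ t = hideEvents A s} ∪
      {t | ∃ (u : ℕ → E) (n : ℕ), (∀ i, n ≤ i → u i ∈ A) ∧
        (∀ k, ⟨firstEvents u k, false⟩ ∈ p.T) ∧ t = hideEvents A (firstEvents u n)})
    ⟨_, p.nil_mem, by simp [hideEvents]⟩
    (by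
      rintro s _ ⟨t, ht, rfl⟩ h
      obtain ⟨l, hl, rfl⟩ := List.prefix_filter_iff.1 h
      exact ⟨⟨l, false⟩, p.closed _ t ht (Or.inr ⟨rfl, hl⟩), rfl⟩)
    (by
      rintro _ (⟨s, hs, rfl⟩ | ⟨u, n, -, hu, rfl⟩)
      · exact ⟨_, p.div_subset hs, rfl⟩
      · exact ⟨_, hu n, rfl⟩)

/-- Renaming is applied element-wise to traces and fixes `✓`. -/
def rename (p : Proc E) (R : E → E → Prop) : Proc E :=
  extend
    {t | ∃ s ∈ p.T, List.Forall₂ R s.events t.events ∧ s.tick = t.tick}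
    {t | ∃ s : List E, ⟨s, false⟩ ∈ p.D ∧ List.Forall₂ R s t}
    ⟨_, p.nil_mem, .nil, rfl⟩
    (by
      rintro s t ⟨r, hr, h, -⟩ hs
      obtain ⟨r', hr', h'⟩ := forall₂_initial h hs
      exact ⟨⟨r', false⟩, p.closed _ r hr (Or.inr ⟨rfl, hr'⟩), h', rfl⟩)
    (by
      rintro t ⟨s, hs, h⟩
      exact ⟨_, p.div_subset hs, h, rfl⟩)

def par (A : Set E) (p q : Proc E) : Proc E :=
  extend
    {u | ∃ s ∈ p.T, ∃ t ∈ q.T, Trace.Merge A s t u}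
    {u | ∃ s ∈ p.T, ∃ t ∈ q.T, Trace.Merge A s t ⟨u, false⟩ ∧ (s ∈ p.D ∨ t ∈ q.D)}
    ⟨_, p.nil_mem, _, q.nil_mem, .nil, rfl, rfl⟩
    (by
      rintro v u ⟨s, hs, t, ht, h, -, -⟩ hv
      obtain ⟨s', t', hs', ht', h'⟩ := h.exists_of_initial hv
      exact ⟨⟨s', false⟩, p.closed _ s hs (Or.inr ⟨rfl, hs'⟩), ⟨t', false⟩,
        q.closed _ t ht (Or.inr ⟨rfl, ht'⟩), h', rfl, rfl⟩)
    (by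
      rintro u ⟨s, hs, t, ht, h, -⟩
      exact ⟨s, hs, t, ht, h⟩)

/-! The operators are monotone. -/

theorem pre_mono (a : E) {p p' : Proc E} (h : p ≤ p') : pre a p ≤ pre a p' := by
  refine ⟨Set.union_subset_union_right _ ?_, ?_⟩
  · rintro t ⟨s, hs, rfl⟩
    exact ⟨s, h.1 hs, rfl⟩
  · rintro t ⟨s, hs, rfl⟩
    exact ⟨s, h.2 hs, rfl⟩

theorem choice_mono {p p' q q' : Proc E} (h : p ≤ p') (k : q ≤ q') :
    choice p q ≤ choice p' q' :=
  ⟨Set.union_subset_union h.1 k.1, Set.union_subset_union h.2 k.2⟩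

theorem seqD_mono {p p' q q' : Proc E} (h : p ≤ p') (k : q ≤ q') :
    seqD p' q' ⊆ seqD p q := by
  rintro t (ht | ⟨s, hs, r, hr, rfl⟩)
  · exact Or.inl (h.2 ht)
  · exact Or.inr ⟨s, h.1 hs, r, k.2 hr, rfl⟩

theorem seq_mono {p p' q q' : Proc E} (h : p ≤ p') (k : q ≤ q') : seq p q ≤ seq p' q' := by
  refine ⟨?_, seqD_mono h k⟩
  rintro t ((⟨ht, ht'⟩ | ⟨s, hs, r, hr, rfl⟩) | ht)
  · exact Or.inl (Or.inl ⟨h.1 ht, ht'⟩)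
  · exact Or.inl (Or.inr ⟨s, h.1 hs, r, k.1 hr, rfl⟩)
  · exact Or.inr (seqD_mono h k ht)

theorem extend_mono {T₀ T₁ : Set (Trace E)} {B₀ B₁ : Set (List E)} {a₀ b₀ c₀ a₁ b₁ c₁}
    (hT : T₁ ⊆ T₀) (hB : B₁ ⊆ B₀) : extend T₀ B₀ a₀ b₀ c₀ ≤ extend T₁ B₁ a₁ b₁ c₁ := by
  have key : {t | ∃ s ∈ B₁, ∃ r, t = Trace.cat s r} ⊆ {t | ∃ s ∈ B₀, ∃ r, t = Trace.cat s r} := by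
    rintro t ⟨s, hs, r, rfl⟩
    exact ⟨s, hB hs, r, rfl⟩
  exact ⟨Set.union_subset_union hT key, key⟩

theorem hide_mono (A : Set E) {p p' : Proc E} (h : p ≤ p') : hide p A ≤ hide p' A := by
  refine extend_mono ?_ (Set.union_subset_union ?_ ?_)
  · rintro t ⟨s, hs, rfl⟩
    exact ⟨s, h.1 hs, rfl⟩
  · rintro t ⟨s, hs, rfl⟩
    exact ⟨s, h.2 hs, rfl⟩
  · rintro t ⟨u, n, hn, hu, rfl⟩
    exact ⟨u, n, hn, fun k => h.1 (hu k), rfl⟩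

theorem rename_mono (R : E → E → Prop) {p p' : Proc E} (h : p ≤ p') :
    rename p R ≤ rename p' R := by
  refine extend_mono ?_ ?_
  · rintro t ⟨s, hs, hst⟩
    exact ⟨s, h.1 hs, hst⟩
  · rintro t ⟨s, hs, hst⟩
    exact ⟨s, h.2 hs, hst⟩

theorem par_mono (A : Set E) {p p' q q' : Proc E} (h : p ≤ p') (k : q ≤ q') :
    par A p q ≤ par A p' q' := by
  refine extend_mono ?_ ?_
  · rintro u ⟨s, hs, t, ht, hu⟩
    exact ⟨s, h.1 hs, t, k.1 ht, hu⟩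
  · rintro u ⟨s, hs, t, ht, hu, hd⟩
    exact ⟨s, h.1 hs, t, k.1 ht, hu, hd.imp (fun x => h.2 x) (fun x => k.2 x)⟩

/-- `p` must communicate an event of `V` before it can perform `✓`. -/
def TickGuarded (p : Proc E) (V : Set E) : Prop :=
  ∀ s : List E, (⟨s, true⟩ : Trace E) ∈ p.T → ∃ a ∈ s, a ∈ V

end Proc

/-- The denotation of a term as a monotone map from assignments of processes to the variables;
recursion is the least fixed point. -/
noncomputable def denote [DecidableEq Var] : Term E Var → ((Var → Proc E) →o Proc E)
  | .STOP => ⟨fun _ => Proc.STOP, fun _ _ _ => le_rfl⟩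
  | .pre a P => ⟨fun ρ => Proc.pre a (denote P ρ), fun _ _ h => Proc.pre_mono a ((denote P).2 h)⟩
  | .SKIP => ⟨fun _ => Proc.SKIP, fun _ _ _ => le_rfl⟩
  | .intChoice P Q => ⟨fun ρ => Proc.choice (denote P ρ) (denote Q ρ),
      fun _ _ h => Proc.choice_mono ((denote P).2 h) ((denote Q).2 h)⟩
  | .extChoice P Q => ⟨fun ρ => Proc.choice (denote P ρ) (denote Q ρ),
      fun _ _ h => Proc.choice_mono ((denote P).2 h) ((denote Q).2 h)⟩
  | .par A P Q => ⟨fun ρ => Proc.par A (denote P ρ) (denote Q ρ),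
      fun _ _ h => Proc.par_mono A ((denote P).2 h) ((denote Q).2 h)⟩
  | .seq P Q => ⟨fun ρ => Proc.seq (denote P ρ) (denote Q ρ),
      fun _ _ h => Proc.seq_mono ((denote P).2 h) ((denote Q).2 h)⟩
  | .hide P A => ⟨fun ρ => Proc.hide (denote P ρ) A,
      fun _ _ h => Proc.hide_mono A ((denote P).2 h)⟩
  | .rename P R => ⟨fun ρ => Proc.rename (denote P ρ) R,
      fun _ _ h => Proc.rename_mono R ((denote P).2 h)⟩
  | .var X => ⟨fun ρ => ρ X, fun _ _ h => h X⟩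
  | .mu X P =>
      ⟨fun ρ => OrderHom.lfp ⟨fun p => denote P (Function.update ρ X p),
          fun _ _ h => (denote P).2 (update_le_update_iff.2 ⟨h, fun _ _ => le_rfl⟩)⟩,
        fun _ _ h => OrderHom.lfp.2 fun _ => (denote P).2
          (update_le_update_iff.2 ⟨le_rfl, fun j _ => h j⟩)⟩
  | .DIV => ⟨fun _ => Proc.DIV, fun _ _ _ => le_rfl⟩

/-! ### Nonexpansive, guard, contractive and fair sets -/

/-- The image `R(U)` of a set under a renaming relation. -/
def relImage (R : E → E → Prop) (U : Set E) : Set E := {y | ∃ x ∈ U, R x y}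

open Classical in
/-- The nonexpansive sets `N_X(P)`. -/
noncomputable def nonexp (X : Var) : Term E Var → Set (Set E × Set E)
  | .STOP => Set.univ
  | .SKIP => Set.univ
  | .DIV => Set.univ
  | .pre a P => if X ∉ (Term.pre a P).fv then Set.univ else nonexp X P
  | .intChoice P Q =>
      if X ∉ (Term.intChoice P Q).fv then Set.univ else nonexp X P ∩ nonexp X Q
  | .extChoice P Q =>
      if X ∉ (Term.extChoice P Q).fv then Set.univ else nonexp X P ∩ nonexp X Q
  | .par A P Q =>
      if X ∉ (Term.par A P Q).fv then Set.univ else nonexp X P ∩ nonexp X Q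
  | .seq P Q =>
      if X ∉ (Term.seq P Q).fv then Set.univ else nonexp X P ∩ nonexp X Q
  | .hide P A =>
      if X ∉ (Term.hide P A).fv then Set.univ
      else {p | ∃ V', (p.1, V') ∈ nonexp X P ∧ V' ∩ A = ∅ ∧ V' ⊆ p.2}
  | .rename P R =>
      if X ∉ (Term.rename P R).fv then Set.univ
      else {p | ∃ V', (p.1, V') ∈ nonexp X P ∧ relImage R V' ⊆ p.2}
  | .var Y =>
      if X ∉ (Term.var Y : Term E Var).fv then Set.univ else {p | p.1 ⊆ p.2}
  | .mu Y P =>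
      if X ∉ (Term.mu Y P).fv then Set.univ
      else {p | ∃ U' V', (U', V') ∈ nonexp X P ∧ (V', V') ∈ nonexp Y P ∧ p.1 ⊆ U' ∧ V' ⊆ p.2}

open Classical in
mutual

/-- The guard sets `G(P)`. -/
noncomputable def guards : Term E Var → Set (Set E)
  | .STOP => Set.univ
  | .SKIP => ∅
  | .DIV => ∅
  | .pre a P => guards P ∪ {V | a ∈ V}
  | .intChoice P Q => guards P ∩ guards Q
  | .extChoice P Q => guards P ∩ guards Q
  | .seq P Q =>
      if P.IsClosed ∧ (fair P).Nonempty then guards P ∪ guards Q else guards P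
  | .par _ P Q =>
      if (P.IsClosed ∧ (fair P).Nonempty) ∧ (Q.IsClosed ∧ (fair Q).Nonempty)
      then guards P ∪ guards Q else guards P ∩ guards Q
  | .hide P A =>
      if P.IsClosed ∧ (∅, Aᶜ) ∈ fair P
      then {V | ∃ V' ∈ guards P, V' ∩ A = ∅ ∧ V' ⊆ V} else ∅
  | .rename P R => {V | ∃ V' ∈ guards P, relImage R V' ⊆ V}
  | .var _ => ∅
  | .mu _ P => guards P

/-- The contractive sets `C_X(P)`. -/
noncomputable def contr : Term E Var → Var → Set (Set E × Set E)
  | .STOP, _ => Set.univ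
  | .SKIP, _ => Set.univ
  | .DIV, _ => Set.univ
  | .pre a P, X =>
      if X ∉ (Term.pre a P).fv then Set.univ
      else contr P X ∪ {p | p ∈ nonexp X P ∧ a ∈ p.2}
  | .intChoice P Q, X =>
      if X ∉ (Term.intChoice P Q).fv then Set.univ else contr P X ∩ contr Q X
  | .extChoice P Q, X =>
      if X ∉ (Term.extChoice P Q).fv then Set.univ else contr P X ∩ contr Q X
  | .par A P Q, X =>
      if X ∉ (Term.par A P Q).fv then Set.univ else contr P X ∩ contr Q X
  | .seq P Q, X =>
      if X ∉ (Term.seq P Q).fv then Set.univ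
      else contr P X ∩ (contr Q X ∪ {p | p ∈ nonexp X Q ∧ p.2 ∈ guards P})
  | .hide P A, X =>
      if X ∉ (Term.hide P A).fv then Set.univ
      else {p | ∃ V', (p.1, V') ∈ contr P X ∧ V' ∩ A = ∅ ∧ V' ⊆ p.2}
  | .rename P R, X =>
      if X ∉ (Term.rename P R).fv then Set.univ
      else {p | ∃ V', (p.1, V') ∈ contr P X ∧ relImage R V' ⊆ p.2}
  | .var Y, X =>
      if X ∉ (Term.var Y : Term E Var).fv then Set.univ else ∅
  | .mu Y P, X =>
      if X ∉ (Term.mu Y P).fv then Set.univ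
      else {p | ∃ U' V', (U', V') ∈ contr P X ∧ (V', V') ∈ nonexp Y P ∧ p.1 ⊆ U' ∧ V' ⊆ p.2}

/-- The fair sets `F(P)`. No pair is assigned to `DIV`. -/
noncomputable def fair : Term E Var → Set (Set E × Set E)
  | .STOP => Set.univ
  | .SKIP => Set.univ
  | .DIV => ∅
  | .pre _ P => fair P
  | .intChoice P Q => fair P ∩ fair Q
  | .extChoice P Q => fair P ∩ fair Q
  | .seq P Q => fair P ∩ fair Q
  | .par A P Q =>
      (fair P ∩ fair Q) ∪
        {p | ∃ U₁ V₁ U₂, (U₁, V₁) ∈ fair P ∧ (U₂, A) ∈ fair Q ∧ p = (U₁ ∩ U₂, V₁)} ∪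
        {p | ∃ U₁ U₂ V₂, (U₂, V₂) ∈ fair Q ∧ (U₁, A) ∈ fair P ∧ p = (U₁ ∩ U₂, V₂)}
  | .hide P A => {p | ∃ V', (p.1, V') ∈ fair P ∧ V' ∩ A = ∅ ∧ V' ⊆ p.2}
  | .rename P R => {p | ∃ V', (p.1, V') ∈ fair P ∧ relImage R V' ⊆ p.2}
  | .var _ => {p | p.1 ⊆ p.2}
  | .mu X P =>
      if (Term.mu X P).IsClosed
      then {p | ∃ W, (W, W) ∈ contr P X ∩ fair P ∧ W ⊆ p.2}
      else {p | ∃ W, (W, W) ∈ contr P X ∩ fair P ∧ p.1 ⊆ W ∧ W ⊆ p.2}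

end

end

end CSP

namespace CSP

variable {E : Type*} {Var : Type*}

-- The claim about `guards` cannot be proved alone. A process that diverges has every extension of
-- its divergence as a trace, in particular `✓` at once, so the stronger guard clauses for `;`, `∥`
-- and hiding are sound only because the operands do not diverge, or do not diverge when hidden;
-- this is what `fair` certifies. Fairness of `μ X. P` rests in turn on contractivity of `P` in `X`,
-- and contractivity of `P; Q` may rest on `P` performing an event of `V` before `✓`, which is the
-- claim about `guards` again. Each appeal is to an immediate subterm, so one structural induction,
-- `sound`, proves all three.
--
-- The semantic counterparts are stated by counting events. `Approx V n p q` is a one-sided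
-- comparison of behaviours with fewer than `n` events of `V`. Membership in `nonexp` preserves the
-- level `n` (`approx_of_mem_nonexp`), and membership in `contr` raises it by one (`ContrSound`).
-- `IsFair` replaces a statement about infinite traces by bounds on lengths of finite ones, so
-- preservation by the operators becomes arithmetic with bounds.
--
-- For recursion, `Approx.lfp` transfers approximation to least fixed points, and `isFair_lfp`
-- obtains fairness of a fixed point from its fair approximants: each instance of fairness involves
-- only boundedly many events of `V`. Guardedness of `μ X. P` needs no approximation, since the
-- fixed point is the value of `P` at one particular assignment. Substituting closed terms also
-- amounts to choosing an assignment (`denote_subst`).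

/-! ### Counting events -/

open Classical in
/-- The number of occurrences of events of `V` in `s`. -/
noncomputable def count (V : Set E) (s : List E) : ℕ := s.countP (fun e => e ∈ V)

theorem count_append (V : Set E) (s t : List E) : count V (s ++ t) = count V s + count V t :=
  List.countP_append

theorem count_mono {U V : Set E} (h : U ⊆ V) (s : List E) : count U s ≤ count V s :=
  List.countP_mono_left fun x _ hx => by
    simp only [decide_eq_true_eq] at hx ⊢
    exact h hx

theorem count_cons_le (V : Set E) (a : E) (s : List E) : count V s ≤ count V (a :: s) := by
  classical
  simp only [count, List.countP_cons]
  omega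

theorem count_cons_of_mem {V : Set E} {a : E} (h : a ∈ V) (s : List E) :
    count V (a :: s) = count V s + 1 := by
  classical
  simp [count, h]

theorem count_cons_of_notMem {V : Set E} {a : E} (h : a ∉ V) (s : List E) :
    count V (a :: s) = count V s := by
  classical
  simp [count, h]

theorem count_cons_le_count_cons {V W : Set E} {a b : E} {s t : List E} (h : a ∈ V → b ∈ W)
    (hs : count V s ≤ count W t) : count V (a :: s) ≤ count W (b :: t) := by
  by_cases ha : a ∈ V
  · rw [count_cons_of_mem ha, count_cons_of_mem (h ha)]
    omega
  · rw [count_cons_of_notMem ha]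
    exact hs.trans (count_cons_le _ _ _)

theorem count_pos {V : Set E} {s : List E} (h : ∃ a ∈ s, a ∈ V) : 0 < count V s := by
  classical
  simpa [count, List.countP_pos_iff] using h

theorem count_le_length (V : Set E) (s : List E) : count V s ≤ s.length := List.countP_le_length

theorem count_hideEvents {V A : Set E} (h : V ∩ A = ∅) (s : List E) :
    count V (hideEvents A s) = count V s := by
  classical
  simp only [count, hideEvents, List.countP_filter]
  refine List.countP_congr fun x _ => ?_
  have : x ∈ V → x ∉ A := fun hV hA => (h ▸ (⟨hV, hA⟩ : x ∈ V ∩ A) : x ∈ (∅ : Set E))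
  simpa using this

theorem count_le_of_forall₂ {R : E → E → Prop} {V W : Set E} (h : relImage R V ⊆ W)
    {s t : List E} (hst : List.Forall₂ R s t) : count V s ≤ count W t := by
  induction hst with
  | nil => exact le_rfl
  | cons hr _ ih => exact count_cons_le_count_cons (fun ha => h ⟨_, ha, hr⟩) ih

theorem Merge.count_left {A : Set E} (V : Set E) {s t u : List E} (h : Merge A s t u) :
    count V s ≤ count V u := by
  induction h with
  | nil => exact le_rfl
  | left _ _ ih => exact count_cons_le_count_cons id ih
  | right _ _ ih => exact ih.trans (count_cons_le _ _ _)
  | sync _ _ ih => exact count_cons_le_count_cons id ih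

theorem Merge.symm {A : Set E} {s t u : List E} (h : Merge A s t u) : Merge A t s u := by
  induction h with
  | nil => exact .nil
  | left hb _ ih => exact .right hb ih
  | right hb _ ih => exact .left hb ih
  | sync hb _ ih => exact .sync hb ih

theorem Merge.count_right {A : Set E} (V : Set E) {s t u : List E} (h : Merge A s t u) :
    count V t ≤ count V u := h.symm.count_left V

theorem Merge.length_le {A : Set E} {s t u : List E} (h : Merge A s t u) :
    u.length ≤ s.length + t.length := by
  induction h with
  | nil => simp
  | left _ _ ih | right _ _ ih | sync _ _ ih => simp only [List.length_cons]; omega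

/-- Unsynchronised steps lie outside `A` and synchronised ones occur on both sides. This carries a
bound on one operand of a parallel composition over to the other. -/
theorem Merge.count_sync {A : Set E} {s t u : List E} (h : Merge A s t u) :
    count A s = count A t := by
  induction h with
  | nil => rfl
  | left hb _ ih => rw [count_cons_of_notMem hb, ih]
  | right hb _ ih => rw [count_cons_of_notMem hb, ih]
  | sync ha _ ih => rw [count_cons_of_mem ha, count_cons_of_mem ha, ih]

theorem Merge.mem_left {A : Set E} {s t u : List E} (h : Merge A s t u) {a : E} (ha : a ∈ s) :
    a ∈ u := by
  induction h with
  | nil => exact ha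
  | left _ _ ih | sync _ _ ih =>
    rcases List.mem_cons.1 ha with rfl | ha
    · exact List.mem_cons_self
    · exact List.mem_cons_of_mem _ (ih ha)
  | right _ _ ih => exact List.mem_cons_of_mem _ (ih ha)

theorem Merge.mem_right {A : Set E} {s t u : List E} (h : Merge A s t u) {a : E} (ha : a ∈ t) :
    a ∈ u := h.symm.mem_left ha

theorem exists_mem_of_forall₂ {R : E → E → Prop} {s t : List E} (h : List.Forall₂ R s t) {a : E}
    (ha : a ∈ s) : ∃ b ∈ t, R a b := by
  induction h with
  | nil => exact absurd ha List.not_mem_nil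
  | cons hr _ ih =>
    rcases List.mem_cons.1 ha with rfl | ha
    · exact ⟨_, List.mem_cons_self, hr⟩
    · obtain ⟨b, hb, h⟩ := ih ha
      exact ⟨b, List.mem_cons_of_mem _ hb, h⟩

theorem length_firstEvents (u : ℕ → E) (n : ℕ) : (firstEvents u n).length = n := by
  simp [firstEvents]

theorem firstEvents_succ (u : ℕ → E) (n : ℕ) : firstEvents u (n + 1) = firstEvents u n ++ [u n] := by
  simp [firstEvents, List.range_succ]

/-- Applied to the infinite sequences behind a divergence of `p \ A`: they end in `A`, so for `V`
disjoint from `A` the counts of all initial segments are bounded at once. -/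
theorem count_firstEvents_le {u : ℕ → E} {V : Set E} {n : ℕ} (h : ∀ i, n ≤ i → u i ∉ V) (k : ℕ) :
    count V (firstEvents u k) ≤ count V (firstEvents u n) := by
  induction k with
  | zero => exact Nat.zero_le _
  | succ k ih =>
    rcases le_or_gt n k with hk | hk
    · rw [firstEvents_succ, count_append, count_cons_of_notMem (h k hk)]
      exact ih
    · have : firstEvents u (k + 1) <+: firstEvents u n := by
        refine List.IsPrefix.map _ ?_
        rw [List.prefix_iff_eq_take]
        simp [List.take_range, Nat.min_eq_left hk]
      obtain ⟨r, hr⟩ := this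
      rw [← hr, count_append]
      exact Nat.le_add_right _ _

namespace Proc

/-! ### Approximation -/

/-- The traces and the divergences of `p` with fewer than `n` events of `V` are traces and
divergences of `q`. -/
def Approx (V : Set E) (n : ℕ) (p q : Proc E) : Prop :=
  ∀ s : Trace E, count V s.events < n → (s ∈ p.T → s ∈ q.T) ∧ (s ∈ p.D → s ∈ q.D)

theorem Approx.refl (V : Set E) (n : ℕ) (p : Proc E) : Approx V n p p := fun _ _ => ⟨id, id⟩

theorem Approx.zero (V : Set E) (p q : Proc E) : Approx V 0 p q :=
  fun _ h => absurd h (Nat.not_lt_zero _)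

theorem Approx.trans {V : Set E} {n : ℕ} {p q r : Proc E} (h : Approx V n p q)
    (k : Approx V n q r) : Approx V n p r :=
  fun s hs => ⟨fun x => (k s hs).1 ((h s hs).1 x), fun x => (k s hs).2 ((h s hs).2 x)⟩

theorem Approx.mono {U V : Set E} {n : ℕ} {p q : Proc E} (h : Approx U n p q) (hUV : U ⊆ V) :
    Approx V n p q :=
  fun s hs => h s ((count_mono hUV _).trans_lt hs)

theorem Approx.pre {V : Set E} {n : ℕ} {p q : Proc E} (h : Approx V n p q) (a : E) :
    Approx V n (pre a p) (pre a q) := by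
  intro s hs
  refine ⟨?_, ?_⟩
  · rintro (hs' | ⟨r, hr, rfl⟩)
    · exact Or.inl hs'
    · exact Or.inr ⟨r, (h r ((count_cons_le _ a _).trans_lt hs)).1 hr, rfl⟩
  · rintro ⟨r, hr, rfl⟩
    exact ⟨r, (h r ((count_cons_le _ a _).trans_lt hs)).2 hr, rfl⟩

/-- The prefixed event itself counts, so the remaining trace has one event of `V` fewer. -/
theorem Approx.pre_succ {V : Set E} {n : ℕ} {p q : Proc E} (h : Approx V n p q) {a : E}
    (ha : a ∈ V) : Approx V (n + 1) (Proc.pre a p) (Proc.pre a q) := by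
  have key : ∀ r : Trace E, count V (Trace.cat [a] r).events < n + 1 → count V r.events < n := by
    intro r hr
    rw [Trace.cat, List.singleton_append, count_cons_of_mem ha] at hr
    omega
  intro s hs
  refine ⟨?_, ?_⟩
  · rintro (hs' | ⟨r, hr, rfl⟩)
    · exact Or.inl hs'
    · exact Or.inr ⟨r, (h r (key r hs)).1 hr, rfl⟩
  · rintro ⟨r, hr, rfl⟩
    exact ⟨r, (h r (key r hs)).2 hr, rfl⟩

theorem Approx.choice {V : Set E} {n : ℕ} {p p' q q' : Proc E} (h : Approx V n p p')
    (k : Approx V n q q') : Approx V n (choice p q) (choice p' q') :=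
  fun s hs => ⟨Or.imp (h s hs).1 (k s hs).1, Or.imp (h s hs).2 (k s hs).2⟩

/-- The second component of a sequential composition matters only after the first has terminated. -/
theorem Approx.seq_of_tick {V : Set E} {n : ℕ} {p p' q q' : Proc E} (h : Approx V n p p')
    (k : ∀ s : List E, ⟨s, true⟩ ∈ p.T → ∀ r : Trace E, count V (s ++ r.events) < n →
      (r ∈ q.T → r ∈ q'.T) ∧ (r ∈ q.D → r ∈ q'.D)) :
    Approx V n (seq p q) (seq p' q') := by
  have left : ∀ (s : List E) (r : Trace E), count V (s ++ r.events) < n →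
      (⟨s, true⟩ : Trace E) ∈ p.T → (⟨s, true⟩ : Trace E) ∈ p'.T := by
    intro s r hs
    rw [count_append] at hs
    exact (h ⟨s, true⟩ (lt_of_le_of_lt (Nat.le_add_right _ _) hs)).1
  have key : ∀ s : Trace E, count V s.events < n → s ∈ seqD p q → s ∈ seqD p' q' := by
    rintro s hs (hs' | ⟨t, ht, r, hr, rfl⟩)
    · exact Or.inl ((h s hs).2 hs')
    · exact Or.inr ⟨t, left t r hs ht, r, (k t ht r hs).2 hr, rfl⟩
  intro s hs
  refine ⟨?_, key s hs⟩
  rintro ((⟨hs', htick⟩ | ⟨t, ht, r, hr, rfl⟩) | hs')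
  · exact Or.inl (Or.inl ⟨(h s hs).1 hs', htick⟩)
  · exact Or.inl (Or.inr ⟨t, left t r hs ht, r, (k t ht r hs).1 hr, rfl⟩)
  · exact Or.inr (key s hs hs')

theorem Approx.seq {V : Set E} {n : ℕ} {p p' q q' : Proc E} (h : Approx V n p p')
    (k : Approx V n q q') : Approx V n (seq p q) (seq p' q') := by
  refine h.seq_of_tick fun s _ r hr => k r ?_
  rw [count_append] at hr
  omega

/-- Termination of `p` has already used up an event of `V`, so `q` is only observed at level `n`. -/
theorem Approx.seq_succ {V : Set E} {n : ℕ} {p p' q q' : Proc E} (h : Approx V (n + 1) p p')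
    (k : Approx V n q q') (hp : p.TickGuarded V) :
    Approx V (n + 1) (Proc.seq p q) (Proc.seq p' q') := by
  refine h.seq_of_tick fun s hs r hr => k r ?_
  have := count_pos (hp s hs)
  rw [count_append] at hr
  omega

/-- Appending an arbitrary trace never lowers the count, so it is enough to compare the generating
sets. -/
theorem Approx.extend {V : Set E} {n : ℕ} {T₀ T₁ : Set (Trace E)} {B₀ B₁ : Set (List E)}
    {a₀ b₀ c₀ a₁ b₁ c₁} (hT : ∀ s ∈ T₀, count V s.events < n → s ∈ T₁)
    (hB : ∀ s ∈ B₀, count V s < n → s ∈ B₁) :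
    Approx V n (extend T₀ B₀ a₀ b₀ c₀) (extend T₁ B₁ a₁ b₁ c₁) := by
  have key : ∀ s : Trace E, count V s.events < n →
      (∃ t ∈ B₀, ∃ r, s = Trace.cat t r) → ∃ t ∈ B₁, ∃ r, s = Trace.cat t r := by
    rintro s hs ⟨t, ht, r, rfl⟩
    rw [Trace.cat, count_append] at hs
    exact ⟨t, hB t ht (by omega), r, rfl⟩
  exact fun s hs => ⟨Or.imp (fun h => hT s h hs) (key s hs), key s hs⟩

theorem Approx.hide {V V' A : Set E} {n : ℕ} {p q : Proc E} (h : Approx V' n p q)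
    (hA : V' ∩ A = ∅) (hV : V' ⊆ V) : Approx V n (hide p A) (hide q A) := by
  have key : ∀ s : List E, count V (hideEvents A s) < n → count V' s < n := by
    intro s hs
    rw [← count_hideEvents hA]
    exact (count_mono hV _).trans_lt hs
  refine Approx.extend ?_ ?_
  · rintro _ ⟨s, hs, rfl⟩ hn
    exact ⟨s, (h s (key _ hn)).1 hs, rfl⟩
  · rintro _ (⟨s, hs, rfl⟩ | ⟨u, m, hu, hp, rfl⟩) hn
    · exact Or.inl ⟨s, (h ⟨s, false⟩ (key _ hn)).2 hs, rfl⟩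
    · refine Or.inr ⟨u, m, hu, fun k => (h _ ?_).1 (hp k), rfl⟩
      -- Every initial segment of `u` has to be a trace of `q`, not only the one of length `m`;
      -- those beyond `m` add no event of `V'`.
      refine (count_firstEvents_le (n := m) (fun i hi hiV => ?_) k).trans_lt (key _ hn)
      exact (hA ▸ (⟨hiV, hu i hi⟩ : u i ∈ V' ∩ A) : u i ∈ (∅ : Set E))

theorem Approx.rename {V V' : Set E} {R : E → E → Prop} {n : ℕ} {p q : Proc E}
    (h : Approx V' n p q) (hV : relImage R V' ⊆ V) : Approx V n (rename p R) (rename q R) := by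
  refine Approx.extend ?_ ?_
  · rintro t ⟨s, hs, hst, htick⟩ hn
    exact ⟨s, (h s ((count_le_of_forall₂ hV hst).trans_lt hn)).1 hs, hst, htick⟩
  · rintro t ⟨s, hs, hst⟩ hn
    exact ⟨s, (h ⟨s, false⟩ ((count_le_of_forall₂ hV hst).trans_lt hn)).2 hs, hst⟩

theorem Approx.par {V : Set E} {n : ℕ} {p p' q q' : Proc E} (A : Set E) (h : Approx V n p p')
    (k : Approx V n q q') : Approx V n (par A p q) (par A p' q') := by
  refine Approx.extend ?_ ?_
  · rintro u ⟨s, hs, t, ht, hm⟩ hn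
    exact ⟨s, (h s ((hm.1.count_left V).trans_lt hn)).1 hs,
      t, (k t ((hm.1.count_right V).trans_lt hn)).1 ht, hm⟩
  · rintro u ⟨s, hs, t, ht, hm, hd⟩ hn
    have hs' := h s ((hm.1.count_left V).trans_lt hn)
    have ht' := k t ((hm.1.count_right V).trans_lt hn)
    exact ⟨s, hs'.1 hs, t, ht'.1 ht, hm, hd.imp hs'.2 ht'.2⟩

-- Approximation of least fixed points

/-- The intersection of a family of processes. -/
def inter (S : Set (Proc E)) : Proc E where
  T := {t | ∀ p ∈ S, t ∈ p.T}
  D := {t | ∀ p ∈ S, t ∈ p.D}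
  div_subset _ h p hp := p.div_subset (h p hp)
  div_of_tick s h p hp := p.div_of_tick s (h p hp)
  nonempty := ⟨_, fun p _ => p.nil_mem⟩
  closed s t ht hst p hp := p.closed s t (ht p hp) hst
  div_cat s t h p hp := p.div_cat s t (h p hp)

/-- The order is reverse inclusion, so this says that behaviours common to all members of `S` belong
to the supremum. Hence approximation from a fixed `p` passes to suprema, as fixed point induction
requires. -/
theorem sSup_le_inter (S : Set (Proc E)) : sSup S ≤ inter S :=
  sSup_le fun p hp => ⟨fun _ h => h p hp, fun _ h => h p hp⟩

theorem Approx.sSup {V : Set E} {n : ℕ} {p : Proc E} {S : Set (Proc E)}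
    (h : ∀ q ∈ S, Approx V n p q) : Approx V n p (sSup S) :=
  fun s hs => ⟨fun hp => (sSup_le_inter S).1 fun q hq => (h q hq s hs).1 hp,
    fun hp => (sSup_le_inter S).2 fun q hq => (h q hq s hs).2 hp⟩

/-- Fixed point induction on `g` alone, with `lfp f` held fixed on the left and unfolded at each
step. One-sidedness matters: the least element has all behaviours, so it is approximated by
everything. -/
theorem Approx.lfp {V : Set E} {n : ℕ} {f g : Proc E →o Proc E}
    (h : ∀ p q, Approx V n p q → Approx V n (f p) (g q)) :
    Approx V n (OrderHom.lfp f) (OrderHom.lfp g) := by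
  refine OrderHom.lfp_induction g (p := fun q => Approx V n (OrderHom.lfp f) q) ?_ ?_
  · intro q hq _
    have := h _ _ hq
    rwa [OrderHom.map_lfp] at this
  · exact fun S hS => Approx.sSup hS

/-! ### Fairness -/

/-- `p` does not diverge, and its traces with a bounded number of events of `V` have bounded
length. Over a finite alphabet the second condition says that all infinite traces of `p` contain
infinitely many events of `V`. -/
structure IsFair (p : Proc E) (V : Set E) : Prop where
  not_mem_div : ∀ s, s ∉ p.D
  bounded : ∀ n, ∃ B, ∀ s : List E, ⟨s, false⟩ ∈ p.T → count V s ≤ n → s.length ≤ B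

theorem IsFair.mono {p : Proc E} {U V : Set E} (h : p.IsFair U) (hUV : U ⊆ V) : p.IsFair V where
  not_mem_div := h.not_mem_div
  bounded n := by
    obtain ⟨B, hB⟩ := h.bounded n
    exact ⟨B, fun s hs hn => hB s hs ((count_mono hUV s).trans hn)⟩

theorem isFair_STOP (V : Set E) : (STOP : Proc E).IsFair V where
  not_mem_div _ h := h
  bounded _ := ⟨0, by
    intro s hs _
    have hs : (⟨s, false⟩ : Trace E) = ⟨[], false⟩ := hs
    simp_all⟩

theorem isFair_SKIP (V : Set E) : (SKIP : Proc E).IsFair V where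
  not_mem_div _ h := h
  bounded _ := ⟨0, by
    intro s hs _
    have hs : (⟨s, false⟩ : Trace E) = ⟨[], false⟩ ∨ (⟨s, false⟩ : Trace E) = ⟨[], true⟩ := hs
    simp_all⟩

theorem IsFair.pre {p : Proc E} {V : Set E} (h : p.IsFair V) (a : E) : (pre a p).IsFair V where
  not_mem_div := by
    rintro _ ⟨s, hs, -⟩
    exact h.not_mem_div s hs
  bounded n := by
    obtain ⟨B, hB⟩ := h.bounded n
    refine ⟨B + 1, ?_⟩
    rintro s (hs | ⟨⟨r, b⟩, hr, hs⟩) hn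
    · simp only [Set.mem_singleton_iff, Trace.mk.injEq] at hs
      simp [hs.1]
    · simp only [Trace.cat, Trace.mk.injEq] at hs
      obtain ⟨rfl, rfl⟩ := hs
      have := hB r hr ((count_cons_le V a r).trans hn)
      simpa using this

theorem IsFair.choice {p q : Proc E} {V : Set E} (h : p.IsFair V) (k : q.IsFair V) :
    (choice p q).IsFair V where
  not_mem_div s hs := hs.elim (h.not_mem_div s) (k.not_mem_div s)
  bounded n := by
    obtain ⟨B, hB⟩ := h.bounded n
    obtain ⟨C, hC⟩ := k.bounded n
    refine ⟨max B C, ?_⟩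
    rintro s (hs | hs) hn
    · exact (hB s hs hn).trans (le_max_left _ _)
    · exact (hC s hs hn).trans (le_max_right _ _)

theorem IsFair.seq {p q : Proc E} {V : Set E} (h : p.IsFair V) (k : q.IsFair V) :
    (seq p q).IsFair V := by
  have hd : ∀ s, s ∉ seqD p q := by
    rintro s (hs | ⟨_, _, r, hr, _⟩)
    · exact h.not_mem_div s hs
    · exact k.not_mem_div r hr
  refine ⟨hd, fun n => ?_⟩
  obtain ⟨B, hB⟩ := h.bounded n
  obtain ⟨C, hC⟩ := k.bounded n
  refine ⟨B + C, ?_⟩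
  rintro s ((⟨hs, -⟩ | ⟨t, ht, ⟨r, b⟩, hr, hs⟩) | hs) hn
  · exact (hB s hs hn).trans (Nat.le_add_right _ _)
  · simp only [Trace.cat, Trace.mk.injEq] at hs
    obtain ⟨rfl, rfl⟩ := hs
    rw [count_append] at hn
    rw [List.length_append]
    exact Nat.add_le_add
      (hB t (p.closed _ _ ht (Or.inr ⟨rfl, List.prefix_rfl⟩)) (by omega)) (hC r hr (by omega))
  · exact absurd hs (hd _)

/-- An infinite sequence ending in `A` would give arbitrarily long traces with a bounded number of
events of `V`. -/
theorem IsFair.not_mem_hide_div {p : Proc E} {V A : Set E} (h : p.IsFair V) (hA : V ∩ A = ∅)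
    (s : Trace E) : s ∉ (Proc.hide p A).D := by
  rintro ⟨_, ⟨t, ht, rfl⟩ | ⟨u, m, hu, hp, rfl⟩, -⟩
  · exact h.not_mem_div _ ht
  · obtain ⟨B, hB⟩ := h.bounded (count V (firstEvents u m))
    have := hB _ (hp (B + 1)) (count_firstEvents_le (fun i hi hiV =>
      (hA ▸ (⟨hiV, hu i hi⟩ : u i ∈ V ∩ A) : u i ∈ (∅ : Set E))) _)
    rw [length_firstEvents] at this
    omega

theorem IsFair.hide {p : Proc E} {V V' A : Set E} (h : p.IsFair V') (hA : V' ∩ A = ∅)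
    (hV : V' ⊆ V) : (hide p A).IsFair V where
  not_mem_div := h.not_mem_hide_div hA
  bounded n := by
    obtain ⟨B, hB⟩ := h.bounded n
    refine ⟨B, ?_⟩
    rintro s (⟨⟨r, b⟩, hr, hs⟩ | hs) hn
    · simp only [Trace.mk.injEq] at hs
      obtain ⟨rfl, rfl⟩ := hs
      refine List.length_filter_le _ _ |>.trans (hB r hr ?_)
      rw [← count_hideEvents hA]
      exact (count_mono hV _).trans hn
    · exact absurd hs (h.not_mem_hide_div hA _)

theorem IsFair.rename {p : Proc E} {V V' : Set E} {R : E → E → Prop} (h : p.IsFair V')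
    (hV : relImage R V' ⊆ V) : (rename p R).IsFair V := by
  have hd : ∀ s, s ∉ (Proc.rename p R).D := by
    rintro s ⟨_, ⟨t, ht, -⟩, -⟩
    exact h.not_mem_div _ ht
  refine ⟨hd, fun n => ?_⟩
  obtain ⟨B, hB⟩ := h.bounded n
  refine ⟨B, ?_⟩
  rintro s (⟨⟨r, b⟩, hr, hs, hb⟩ | hs) hn
  · simp only at hs hb
    subst hb
    rw [← hs.length_eq]
    exact hB r hr ((count_le_of_forall₂ hV hs).trans hn)
  · exact absurd hs (hd _)

theorem not_mem_par_div {p q : Proc E} (A : Set E) (h : ∀ s, s ∉ p.D) (k : ∀ s, s ∉ q.D)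
    (s : Trace E) : s ∉ (par A p q).D := by
  rintro ⟨_, ⟨t, _, t', _, _, ht | ht⟩, -⟩
  · exact h _ ht
  · exact k _ ht

theorem isFair_par {p q : Proc E} {V A : Set E} (h : ∀ s, s ∉ p.D) (k : ∀ s, s ∉ q.D)
    (hB : ∀ n, ∃ B, ∀ s t u : List E, ⟨s, false⟩ ∈ p.T → ⟨t, false⟩ ∈ q.T → CSP.Merge A s t u →
      count V u ≤ n → u.length ≤ B) : (par A p q).IsFair V where
  not_mem_div := not_mem_par_div A h k
  bounded n := by
    obtain ⟨B, hB⟩ := hB n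
    refine ⟨B, ?_⟩
    rintro u (⟨⟨s, b⟩, hs, ⟨t, c⟩, ht, hm, hb, hc⟩ | hu) hn
    · simp only at hb hc
      subst hb hc
      exact hB s t u hs ht hm hn
    · exact absurd hu (not_mem_par_div A h k _)

theorem IsFair.par {p q : Proc E} {V : Set E} (A : Set E) (h : p.IsFair V) (k : q.IsFair V) :
    (par A p q).IsFair V := by
  refine isFair_par h.not_mem_div k.not_mem_div fun n => ?_
  obtain ⟨B, hB⟩ := h.bounded n
  obtain ⟨C, hC⟩ := k.bounded n
  exact ⟨B + C, fun s t u hs ht hm hn => hm.length_le.trans (Nat.add_le_add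
    (hB s hs ((hm.count_left V).trans hn)) (hC t ht ((hm.count_right V).trans hn)))⟩

theorem IsFair.par_left {p q : Proc E} {V A : Set E} (h : p.IsFair V) (k : q.IsFair A) :
    (Proc.par A p q).IsFair V := by
  refine isFair_par h.not_mem_div k.not_mem_div fun n => ?_
  obtain ⟨B, hB⟩ := h.bounded n
  -- `B` bounds the length of `s`, hence its events of `A`, which are as many as those of `t`.
  obtain ⟨C, hC⟩ := k.bounded B
  refine ⟨B + C, fun s t u hs ht hm hn => ?_⟩
  have hs' := hB s hs ((hm.count_left V).trans hn)
  have ht' := hC t ht (hm.count_sync ▸ (count_le_length A s).trans hs')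
  exact hm.length_le.trans (Nat.add_le_add hs' ht')

theorem IsFair.par_right {p q : Proc E} {V A : Set E} (h : p.IsFair A) (k : q.IsFair V) :
    (Proc.par A p q).IsFair V := by
  refine isFair_par h.not_mem_div k.not_mem_div fun n => ?_
  obtain ⟨C, hC⟩ := k.bounded n
  obtain ⟨B, hB⟩ := h.bounded C
  refine ⟨B + C, fun s t u hs ht hm hn => ?_⟩
  have ht' := hC t ht ((hm.count_right V).trans hn)
  have hs' := hB s hs (hm.count_sync ▸ (count_le_length A t).trans ht')
  exact hm.length_le.trans (Nat.add_le_add hs' ht')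

/-- The least fixed point of a contraction that preserves fairness is fair: it is approximated by
the iterates of the contraction from `STOP`. -/
theorem isFair_lfp {W : Set E} {f : Proc E →o Proc E}
    (hc : ∀ n p q, Approx W n p q → Approx W (n + 1) (f p) (f q))
    (hf : ∀ p : Proc E, p.IsFair W → (f p).IsFair W) : (OrderHom.lfp f).IsFair W := by
  have key : ∀ n, ∃ q : Proc E, q.IsFair W ∧ Approx W n (OrderHom.lfp f) q := by
    intro n
    induction n with
    | zero => exact ⟨STOP, isFair_STOP W, Approx.zero _ _ _⟩
    | succ n ih =>
      obtain ⟨q, hq, hn⟩ := ih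
      have := hc n _ _ hn
      rw [OrderHom.map_lfp] at this
      exact ⟨f q, hf q hq, this⟩
  refine ⟨fun s hs => ?_, fun n => ?_⟩
  -- `Approx` only sees traces with strictly fewer events than its level, hence the successor.
  · obtain ⟨q, hq, h⟩ := key (count W s.events + 1)
    exact hq.not_mem_div s ((h s (Nat.lt_succ_self _)).2 hs)
  · obtain ⟨q, hq, h⟩ := key (n + 1)
    obtain ⟨B, hB⟩ := hq.bounded n
    exact ⟨B, fun s hs hn => hB s ((h ⟨s, false⟩ (Nat.lt_succ_of_le hn)).1 hs) hn⟩

/-! ### Guardedness -/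

/-- After a divergence `✓` is possible immediately, so guarding `✓` also guards divergence. -/
theorem TickGuarded.of_div {p : Proc E} {V : Set E} (h : p.TickGuarded V) {s : Trace E}
    (hs : s ∈ p.D) : ∃ a ∈ s.events, a ∈ V := by
  obtain ⟨s, b⟩ := s
  cases b with
  | true => exact h s (p.div_subset hs)
  | false =>
    have := p.div_cat s ⟨[], true⟩ hs
    simp only [Trace.cat, List.append_nil] at this
    exact h s (p.div_subset this)

theorem tickGuarded_STOP (V : Set E) : (STOP : Proc E).TickGuarded V := by
  intro s hs
  have hs : (⟨s, true⟩ : Trace E) = ⟨[], false⟩ := hs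
  simp at hs

theorem tickGuarded_pre {p : Proc E} {V : Set E} {a : E} (h : p.TickGuarded V ∨ a ∈ V) :
    (pre a p).TickGuarded V := by
  rintro s (hs | ⟨⟨r, b⟩, hr, hs⟩)
  · simp at hs
  · simp only [Trace.cat, Trace.mk.injEq] at hs
    obtain ⟨rfl, rfl⟩ := hs
    rcases h with h | h
    · obtain ⟨c, hc, hV⟩ := h r hr
      exact ⟨c, List.mem_cons_of_mem _ hc, hV⟩
    · exact ⟨a, List.mem_cons_self, h⟩

theorem TickGuarded.choice {p q : Proc E} {V : Set E} (h : p.TickGuarded V)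
    (k : q.TickGuarded V) : (choice p q).TickGuarded V :=
  fun s hs => hs.elim (h s) (k s)

theorem TickGuarded.seq_left {p : Proc E} {V : Set E} (h : p.TickGuarded V) (q : Proc E) :
    (seq p q).TickGuarded V := by
  have key : ∀ (s t : List E) (r : Trace E), (⟨t, true⟩ : Trace E) ∈ p.T →
      (⟨s, true⟩ : Trace E) = Trace.cat t r → ∃ a ∈ s, a ∈ V := by
    intro s t r ht hs
    simp only [Trace.cat, Trace.mk.injEq] at hs
    obtain ⟨a, ha, hV⟩ := h t ht
    exact ⟨a, hs.1 ▸ List.mem_append_left _ ha, hV⟩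
  rintro s ((⟨-, hs⟩ | ⟨t, ht, r, -, hs⟩) | (hs | ⟨t, ht, r, -, hs⟩))
  · exact absurd hs (by simp)
  · exact key s t r ht hs
  · exact h.of_div hs
  · exact key s t r ht hs

/-- If `p` could diverge, `✓` would be available without `q` ever starting. -/
theorem TickGuarded.seq_right {p q : Proc E} {V : Set E} (h : q.TickGuarded V)
    (hp : ∀ s, s ∉ p.D) : (seq p q).TickGuarded V := by
  have key : ∀ (s t : List E) (r : Trace E), r ∈ q.T →
      (⟨s, true⟩ : Trace E) = Trace.cat t r → ∃ a ∈ s, a ∈ V := by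
    rintro s t ⟨r, b⟩ hr hs
    simp only [Trace.cat, Trace.mk.injEq] at hs
    obtain ⟨rfl, rfl⟩ := hs
    obtain ⟨a, ha, hV⟩ := h r hr
    exact ⟨a, List.mem_append_right _ ha, hV⟩
  rintro s ((⟨-, hs⟩ | ⟨t, -, r, hr, hs⟩) | (hs | ⟨t, -, r, hr, hs⟩))
  · exact absurd hs (by simp)
  · exact key s t r hr hs
  · exact absurd hs (hp _)
  · exact key s t r (q.div_subset hr) hs

theorem tickGuarded_extend {T₀ : Set (Trace E)} {B : Set (List E)} {a b c} {V : Set E}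
    (hT : ∀ s, (⟨s, true⟩ : Trace E) ∈ T₀ → ∃ a ∈ s, a ∈ V) (hB : ∀ s ∈ B, ∃ a ∈ s, a ∈ V) :
    (extend T₀ B a b c).TickGuarded V := by
  rintro s (hs | ⟨t, ht, r, hs⟩)
  · exact hT s hs
  · simp only [Trace.cat, Trace.mk.injEq] at hs
    obtain ⟨a, ha, hV⟩ := hB t ht
    exact ⟨a, hs.1 ▸ List.mem_append_left _ ha, hV⟩

theorem TickGuarded.par {p q : Proc E} {V : Set E} (A : Set E) (h : p.TickGuarded V)
    (k : q.TickGuarded V) : (par A p q).TickGuarded V := by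
  refine tickGuarded_extend ?_ ?_
  · rintro u ⟨⟨s, b⟩, hs, t, -, hm, hb, -⟩
    simp only at hb
    subst hb
    obtain ⟨a, ha, hV⟩ := h s hs
    exact ⟨a, hm.mem_left ha, hV⟩
  · rintro u ⟨s, -, t, -, hm, hd | hd⟩
    · obtain ⟨a, ha, hV⟩ := h.of_div hd
      exact ⟨a, hm.1.mem_left ha, hV⟩
    · obtain ⟨a, ha, hV⟩ := k.of_div hd
      exact ⟨a, hm.1.mem_right ha, hV⟩

/-- Without divergence `✓` needs both operands to terminate, so a guard in either one suffices. -/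
theorem tickGuarded_par_of_not_mem_div {p q : Proc E} {V : Set E} (A : Set E)
    (h : ∀ s, s ∉ p.D) (k : ∀ s, s ∉ q.D) (hV : p.TickGuarded V ∨ q.TickGuarded V) :
    (Proc.par A p q).TickGuarded V := by
  refine tickGuarded_extend ?_ ?_
  · rintro u ⟨⟨s, b⟩, hs, ⟨t, c⟩, ht, hm, hb, hc⟩
    simp only at hb hc hm
    subst hb hc
    rcases hV with hV | hV
    · obtain ⟨a, ha, hV⟩ := hV s hs
      exact ⟨a, hm.mem_left ha, hV⟩
    · obtain ⟨a, ha, hV⟩ := hV t ht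
      exact ⟨a, hm.mem_right ha, hV⟩
  · rintro u ⟨s, -, t, -, -, hd | hd⟩
    · exact absurd hd (h _)
    · exact absurd hd (k _)

/-- The guarding event survives hiding. Fairness for `Aᶜ` excludes divergence created by the hiding,
which could otherwise precede that event. -/
theorem TickGuarded.hide {p : Proc E} {V V' A : Set E} (h : p.TickGuarded V') (hA : V' ∩ A = ∅)
    (hV : V' ⊆ V) (hp : p.IsFair Aᶜ) : (hide p A).TickGuarded V := by
  rintro s (⟨⟨r, b⟩, hr, hs⟩ | hs)
  · simp only [Trace.mk.injEq] at hs
    obtain ⟨rfl, rfl⟩ := hs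
    obtain ⟨a, ha, haV⟩ := h r hr
    refine ⟨a, List.mem_filter.2 ⟨ha, ?_⟩, hV haV⟩
    simp only [decide_eq_true_eq]
    exact fun haA => (hA ▸ (⟨haV, haA⟩ : a ∈ V' ∩ A) : a ∈ (∅ : Set E))
  · exact absurd hs (hp.not_mem_hide_div (Set.compl_inter_self A) _)

theorem TickGuarded.rename {p : Proc E} {V V' : Set E} {R : E → E → Prop}
    (h : p.TickGuarded V') (hV : relImage R V' ⊆ V) : (rename p R).TickGuarded V := by
  refine tickGuarded_extend ?_ ?_
  · rintro t ⟨⟨s, b⟩, hs, hst, hb⟩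
    simp only at hb
    subst hb
    obtain ⟨a, ha, haV⟩ := h s hs
    obtain ⟨b, hb, hab⟩ := exists_mem_of_forall₂ hst ha
    exact ⟨b, hb, hV ⟨a, haV, hab⟩⟩
  · rintro t ⟨s, hs, hst⟩
    obtain ⟨a, ha, haV⟩ := h.of_div hs
    obtain ⟨b, hb, hab⟩ := exists_mem_of_forall₂ hst ha
    exact ⟨b, hb, hV ⟨a, haV, hab⟩⟩

end Proc

/-! ### Denotations -/

section
variable [DecidableEq Var]

open Function

theorem denote_var (X : Var) (ρ : Var → Proc E) : denote (.var X) ρ = ρ X := rfl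

theorem denote_congr (P : Term E Var) {ρ ρ' : Var → Proc E} (h : ∀ X ∈ P.fv, ρ X = ρ' X) :
    denote P ρ = denote P ρ' := by
  induction P generalizing ρ ρ' with
  | STOP | SKIP | DIV => rfl
  | pre a P ih => exact congrArg (Proc.pre a) (ih h)
  | intChoice P Q ihP ihQ | extChoice P Q ihP ihQ =>
    exact congrArg₂ Proc.choice (ihP fun X hX => h X (Or.inl hX)) (ihQ fun X hX => h X (Or.inr hX))
  | par A P Q ihP ihQ =>
    exact congrArg₂ (Proc.par A) (ihP fun X hX => h X (Or.inl hX))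
      (ihQ fun X hX => h X (Or.inr hX))
  | seq P Q ihP ihQ =>
    exact congrArg₂ Proc.seq (ihP fun X hX => h X (Or.inl hX)) (ihQ fun X hX => h X (Or.inr hX))
  | hide P A ih => exact congrArg (Proc.hide · A) (ih h)
  | rename P R ih => exact congrArg (Proc.rename · R) (ih h)
  | var X => exact h X rfl
  | mu X P ih =>
    refine congrArg OrderHom.lfp (OrderHom.ext _ _ (funext fun p => ih fun Y hY => ?_))
    by_cases hYX : Y = X
    · subst hYX
      simp
    · simpa [hYX] using h Y ⟨hY, hYX⟩

/-- The value of a substituted term is the value of the term at the values of the substitution. -/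
theorem denote_subst (P : Term E Var) (σ : Var → Term E Var) (ρ : Var → Proc E)
    (h : ∀ X ∈ P.fv, (σ X).IsClosed ∨ σ X = .var X) :
    denote (P.subst σ) ρ = denote P (fun X => denote (σ X) ρ) := by
  induction P generalizing σ ρ with
  | STOP | SKIP | DIV | var => rfl
  | pre a P ih => exact congrArg (Proc.pre a) (ih _ _ h)
  | intChoice P Q ihP ihQ | extChoice P Q ihP ihQ =>
    exact congrArg₂ Proc.choice (ihP _ _ fun X hX => h X (Or.inl hX))
      (ihQ _ _ fun X hX => h X (Or.inr hX))
  | par A P Q ihP ihQ =>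
    exact congrArg₂ (Proc.par A) (ihP _ _ fun X hX => h X (Or.inl hX))
      (ihQ _ _ fun X hX => h X (Or.inr hX))
  | seq P Q ihP ihQ =>
    exact congrArg₂ Proc.seq (ihP _ _ fun X hX => h X (Or.inl hX))
      (ihQ _ _ fun X hX => h X (Or.inr hX))
  | hide P A ih => exact congrArg (Proc.hide · A) (ih _ _ h)
  | rename P R ih => exact congrArg (Proc.rename · R) (ih _ _ h)
  | mu X P ih =>
    refine congrArg OrderHom.lfp (OrderHom.ext _ _ (funext fun p => ?_))
    -- Under the binder the substitution fixes `X`, which is why `h` allows variables sent to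
    -- themselves besides closed terms.
    refine (ih (update σ X (.var X)) (update ρ X p) fun Y hY => ?_).trans
      (denote_congr P fun Y hY => ?_)
    · by_cases hYX : Y = X
      · subst hYX
        simp
      · simpa [hYX] using h Y ⟨hY, hYX⟩
    · by_cases hYX : Y = X
      · subst hYX
        simp [denote_var]
      · simp only [update_of_ne hYX]
        rcases h Y ⟨hY, hYX⟩ with hc | hv
        · refine denote_congr _ fun Z hZ => ?_
          rw [Term.IsClosed] at hc
          simp [hc] at hZ
        · rw [hv]
          simp [denote_var, hYX]

-- Dependence of a denotation on one variable

theorem approx_of_notMem_fv {P : Term E Var} {X : Var} (hX : X ∉ P.fv) (ρ : Var → Proc E)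
    (x y : Proc E) (V : Set E) (n : ℕ) :
    Proc.Approx V n (denote P (update ρ X x)) (denote P (update ρ X y)) := by
  rw [denote_congr P (ρ' := update ρ X y)]
  · exact .refl _ _ _
  · intro Y hY
    have : Y ≠ X := fun h => hX (h ▸ hY)
    simp [this]

/-- A lifting of approximations in `X` to a recursive term `μ Y. P`. -/
theorem approx_mu {P : Term E Var} {X Y : Var} (hXY : X ≠ Y) {V : Set E} {m : ℕ}
    {x y : Proc E} (hX : ∀ ρ : Var → Proc E,
      Proc.Approx V m (denote P (update ρ X x)) (denote P (update ρ X y)))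
    (hY : ∀ (ρ : Var → Proc E) (p q : Proc E), Proc.Approx V m p q →
      Proc.Approx V m (denote P (update ρ Y p)) (denote P (update ρ Y q)))
    (ρ : Var → Proc E) :
    Proc.Approx V m (denote (.mu Y P) (update ρ X x)) (denote (.mu Y P) (update ρ X y)) := by
  refine Proc.Approx.lfp fun p q hpq => ?_
  -- Change the parameter `X` first, with the recursion variable held at `p`, and then `p` to `q`.
  refine Proc.Approx.trans (q := denote P (update (update ρ X y) Y p)) ?_ (hY _ _ _ hpq)
  have := hX (update ρ Y p)
  rwa [update_comm hXY.symm, update_comm hXY.symm] at this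

theorem approx_of_mem_nonexp {P : Term E Var} {X : Var} {U V : Set E}
    (h : (U, V) ∈ nonexp X P) {n : ℕ} {x y : Proc E} (hxy : Proc.Approx U n x y)
    (ρ : Var → Proc E) :
    Proc.Approx V n (denote P (update ρ X x)) (denote P (update ρ X y)) := by
  induction P generalizing X U V x y ρ with
  | STOP | SKIP | DIV => exact .refl _ _ _
  | pre a P ih =>
    by_cases hX : X ∈ (Term.pre a P).fv
    · rw [nonexp, if_neg (not_not.2 hX)] at h
      exact (ih h hxy ρ).pre a
    · exact approx_of_notMem_fv hX _ _ _ _ _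
  | intChoice P Q ihP ihQ =>
    by_cases hX : X ∈ (Term.intChoice P Q).fv
    · rw [nonexp, if_neg (not_not.2 hX)] at h
      exact (ihP h.1 hxy ρ).choice (ihQ h.2 hxy ρ)
    · exact approx_of_notMem_fv hX _ _ _ _ _
  | extChoice P Q ihP ihQ =>
    by_cases hX : X ∈ (Term.extChoice P Q).fv
    · rw [nonexp, if_neg (not_not.2 hX)] at h
      exact (ihP h.1 hxy ρ).choice (ihQ h.2 hxy ρ)
    · exact approx_of_notMem_fv hX _ _ _ _ _
  | par A P Q ihP ihQ =>
    by_cases hX : X ∈ (Term.par A P Q).fv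
    · rw [nonexp, if_neg (not_not.2 hX)] at h
      exact (ihP h.1 hxy ρ).par A (ihQ h.2 hxy ρ)
    · exact approx_of_notMem_fv hX _ _ _ _ _
  | seq P Q ihP ihQ =>
    by_cases hX : X ∈ (Term.seq P Q).fv
    · rw [nonexp, if_neg (not_not.2 hX)] at h
      exact (ihP h.1 hxy ρ).seq (ihQ h.2 hxy ρ)
    · exact approx_of_notMem_fv hX _ _ _ _ _
  | hide P A ih =>
    by_cases hX : X ∈ (Term.hide P A).fv
    · rw [nonexp, if_neg (not_not.2 hX)] at h
      obtain ⟨V', hV', hA, hV⟩ := h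
      exact (ih hV' hxy ρ).hide hA hV
    · exact approx_of_notMem_fv hX _ _ _ _ _
  | rename P R ih =>
    by_cases hX : X ∈ (Term.rename P R).fv
    · rw [nonexp, if_neg (not_not.2 hX)] at h
      obtain ⟨V', hV', hV⟩ := h
      exact (ih hV' hxy ρ).rename hV
    · exact approx_of_notMem_fv hX _ _ _ _ _
  | var Y =>
    by_cases hX : X ∈ (Term.var Y : Term E Var).fv
    · rw [nonexp, if_neg (not_not.2 hX)] at h
      obtain rfl : X = Y := hX
      simpa [denote_var] using hxy.mono h
    · exact approx_of_notMem_fv hX _ _ _ _ _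
  | mu Y P ih =>
    by_cases hX : X ∈ (Term.mu Y P).fv
    · rw [nonexp, if_neg (not_not.2 hX)] at h
      obtain ⟨U', V', hU', hV', hU, hV⟩ := h
      -- The induction hypothesis is used for `X` and for the bound `Y`; the diagonal pair `(V',
      -- V')` makes each unfolding reproduce the same approximation.
      exact (approx_mu hX.2 (fun ρ => ih hU' (hxy.mono hU) ρ)
        (fun ρ p q hpq => ih hV' hpq ρ) ρ).mono hV
    · exact approx_of_notMem_fv hX _ _ _ _ _

-- Soundness of the guard, contractive and fair sets for each operator

/-- Members of `G(P)` guard `✓`. -/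
def GuardSound (P : Term E Var) : Prop :=
  ∀ V ∈ guards P, ∀ ρ : Var → Proc E, (denote P ρ).TickGuarded V

/-- Members of `C_X(P)` make `P` contractive in `X`. -/
def ContrSound (P : Term E Var) : Prop :=
  ∀ (X : Var) (U V : Set E), (U, V) ∈ contr P X → ∀ (n : ℕ) (x y : Proc E),
    Proc.Approx U n x y → ∀ ρ : Var → Proc E,
      Proc.Approx V (n + 1) (denote P (update ρ X x)) (denote P (update ρ X y))

/-- Members of `F(P)` make `P` preserve fairness. -/
def FairSound (P : Term E Var) : Prop :=
  ∀ U V : Set E, (U, V) ∈ fair P → ∀ ρ : Var → Proc E,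
    (∀ X ∈ P.fv, (ρ X).IsFair U) → (denote P ρ).IsFair V

theorem FairSound.of_isClosed {P : Term E Var} (h : FairSound P) (hP : P.IsClosed) {U V : Set E}
    (hUV : (U, V) ∈ fair P) (ρ : Var → Proc E) : (denote P ρ).IsFair V := by
  refine h U V hUV ρ fun X hX => ?_
  rw [Term.IsClosed] at hP
  simp [hP] at hX

/-- Any pair in `fair P` will do: for closed `P` the fairness assumption on `ρ` is vacuous. -/
theorem FairSound.not_mem_div {P : Term E Var} (h : FairSound P)
    (hP : P.IsClosed ∧ (fair P).Nonempty) (ρ : Var → Proc E) (s : Trace E) :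
    s ∉ (denote P ρ).D := by
  obtain ⟨hP, ⟨U, V⟩, hUV⟩ := hP
  exact (h.of_isClosed hP hUV ρ).not_mem_div s

theorem ContrSound.pre {P : Term E Var} (h : ContrSound P) (a : E) : ContrSound (.pre a P) := by
  intro X U V hUV n x y hxy ρ
  by_cases hX : X ∈ (Term.pre a P).fv
  · rw [contr, if_neg (not_not.2 hX)] at hUV
    rcases hUV with hUV | ⟨hUV, ha⟩
    · exact (h X U V hUV n x y hxy ρ).pre a
    · exact (approx_of_mem_nonexp hUV hxy ρ).pre_succ ha
  · exact approx_of_notMem_fv hX _ _ _ _ _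

theorem ContrSound.intChoice {P Q : Term E Var} (h : ContrSound P) (k : ContrSound Q) :
    ContrSound (.intChoice P Q) := by
  intro X U V hUV n x y hxy ρ
  by_cases hX : X ∈ (Term.intChoice P Q).fv
  · rw [contr, if_neg (not_not.2 hX)] at hUV
    exact (h X U V hUV.1 n x y hxy ρ).choice (k X U V hUV.2 n x y hxy ρ)
  · exact approx_of_notMem_fv hX _ _ _ _ _

theorem ContrSound.extChoice {P Q : Term E Var} (h : ContrSound P) (k : ContrSound Q) :
    ContrSound (.extChoice P Q) := by
  intro X U V hUV n x y hxy ρ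
  by_cases hX : X ∈ (Term.extChoice P Q).fv
  · rw [contr, if_neg (not_not.2 hX)] at hUV
    exact (h X U V hUV.1 n x y hxy ρ).choice (k X U V hUV.2 n x y hxy ρ)
  · exact approx_of_notMem_fv hX _ _ _ _ _

theorem ContrSound.par {P Q : Term E Var} (A : Set E) (h : ContrSound P) (k : ContrSound Q) :
    ContrSound (.par A P Q) := by
  intro X U V hUV n x y hxy ρ
  by_cases hX : X ∈ (Term.par A P Q).fv
  · rw [contr, if_neg (not_not.2 hX)] at hUV
    exact (h X U V hUV.1 n x y hxy ρ).par A (k X U V hUV.2 n x y hxy ρ)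
  · exact approx_of_notMem_fv hX _ _ _ _ _

theorem ContrSound.seq {P Q : Term E Var} (h : ContrSound P) (k : ContrSound Q)
    (hg : GuardSound P) : ContrSound (.seq P Q) := by
  intro X U V hUV n x y hxy ρ
  by_cases hX : X ∈ (Term.seq P Q).fv
  · rw [contr, if_neg (not_not.2 hX)] at hUV
    have hP := h X U V hUV.1 n x y hxy ρ
    rcases hUV.2 with hQ | ⟨hQ, hV⟩
    · exact hP.seq (k X U V hQ n x y hxy ρ)
    · exact hP.seq_succ (approx_of_mem_nonexp hQ hxy ρ) (hg V hV _)
  · exact approx_of_notMem_fv hX _ _ _ _ _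

theorem ContrSound.hide {P : Term E Var} (h : ContrSound P) (A : Set E) :
    ContrSound (.hide P A) := by
  intro X U V hUV n x y hxy ρ
  by_cases hX : X ∈ (Term.hide P A).fv
  · rw [contr, if_neg (not_not.2 hX)] at hUV
    obtain ⟨V', hV', hA, hV⟩ := hUV
    exact (h X U V' hV' n x y hxy ρ).hide hA hV
  · exact approx_of_notMem_fv hX _ _ _ _ _

theorem ContrSound.rename {P : Term E Var} (h : ContrSound P) (R : E → E → Prop) :
    ContrSound (.rename P R) := by
  intro X U V hUV n x y hxy ρ
  by_cases hX : X ∈ (Term.rename P R).fv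
  · rw [contr, if_neg (not_not.2 hX)] at hUV
    obtain ⟨V', hV', hV⟩ := hUV
    exact (h X U V' hV' n x y hxy ρ).rename hV
  · exact approx_of_notMem_fv hX _ _ _ _ _

theorem contrSound_var (Y : Var) : ContrSound (.var Y : Term E Var) := by
  intro X U V hUV n x y hxy ρ
  by_cases hX : X ∈ (Term.var Y : Term E Var).fv
  · rw [contr, if_neg (not_not.2 hX)] at hUV
    exact absurd hUV (Set.notMem_empty _)
  · exact approx_of_notMem_fv hX _ _ _ _ _

/-- The gain of a level comes from `X` alone; in `Y` the level `n + 1` merely has to be maintained.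
-/
theorem ContrSound.mu {P : Term E Var} (h : ContrSound P) (Y : Var) : ContrSound (.mu Y P) := by
  intro X U V hUV n x y hxy ρ
  by_cases hX : X ∈ (Term.mu Y P).fv
  · rw [contr, if_neg (not_not.2 hX)] at hUV
    obtain ⟨U', V', hU', hV', hU, hV⟩ := hUV
    exact (approx_mu hX.2 (fun ρ => h X U' V' hU' n x y (hxy.mono hU) ρ)
      (fun ρ p q hpq => approx_of_mem_nonexp hV' hpq ρ) ρ).mono hV
  · exact approx_of_notMem_fv hX _ _ _ _ _

theorem FairSound.par {P Q : Term E Var} (A : Set E) (h : FairSound P) (k : FairSound Q) :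
    FairSound (.par A P Q) := by
  intro U V hUV ρ hρ
  rw [fair] at hUV
  have hP : ∀ X ∈ P.fv, (ρ X).IsFair U := fun X hX => hρ X (Or.inl hX)
  have hQ : ∀ X ∈ Q.fv, (ρ X).IsFair U := fun X hX => hρ X (Or.inr hX)
  rcases hUV with (hUV | ⟨U₁, V₁, U₂, h₁, h₂, hUV⟩) | ⟨U₁, U₂, V₂, h₂, h₁, hUV⟩
  · exact (h U V hUV.1 ρ hP).par A (k U V hUV.2 ρ hQ)
  · obtain ⟨rfl, rfl⟩ := Prod.mk.inj hUV
    exact (h U₁ _ h₁ ρ fun X hX => (hP X hX).mono Set.inter_subset_left).par_left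
      (k U₂ A h₂ ρ fun X hX => (hQ X hX).mono Set.inter_subset_right)
  · obtain ⟨rfl, rfl⟩ := Prod.mk.inj hUV
    exact (h U₁ A h₁ ρ fun X hX => (hP X hX).mono Set.inter_subset_left).par_right
      (k U₂ _ h₂ ρ fun X hX => (hQ X hX).mono Set.inter_subset_right)

/-- The single set `W` serves as input and output of the body, so the map iterated in `isFair_lfp`
both contracts and preserves fairness for `W`. -/
theorem FairSound.mu {P : Term E Var} (h : FairSound P) (hc : ContrSound P) (X : Var) :
    FairSound (.mu X P) := by
  intro U V hUV ρ hρ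
  obtain ⟨W, ⟨hWc, hWf⟩, hρW, hWV⟩ : ∃ W, (W, W) ∈ contr P X ∩ fair P ∧
      (∀ Y ∈ (Term.mu X P).fv, (ρ Y).IsFair W) ∧ W ⊆ V := by
    rw [fair] at hUV
    split_ifs at hUV with hcl
    · obtain ⟨W, hW, hV⟩ := hUV
      refine ⟨W, hW, fun Y hY => ?_, hV⟩
      rw [Term.IsClosed] at hcl
      simp [hcl] at hY
    · obtain ⟨W, hW, hU, hV⟩ := hUV
      exact ⟨W, hW, fun Y hY => (hρ Y hY).mono hU, hV⟩
  refine Proc.IsFair.mono (Proc.isFair_lfp (fun n p q hpq => hc X W W hWc n p q hpq ρ)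
    fun p hp => h W W hWf _ fun Y hY => ?_) hWV
  by_cases hYX : Y = X
  · subst hYX
    simpa using hp
  · simpa [hYX] using hρW Y ⟨hY, hYX⟩

theorem GuardSound.seq {P Q : Term E Var} (h : GuardSound P) (k : GuardSound Q)
    (hf : FairSound P) : GuardSound (.seq P Q) := by
  intro V hV ρ
  rw [guards] at hV
  split_ifs at hV with hP
  · rcases hV with hV | hV
    · exact (h V hV ρ).seq_left _
    · exact (k V hV ρ).seq_right (hf.not_mem_div hP ρ)
  · exact (h V hV ρ).seq_left _

theorem GuardSound.par {P Q : Term E Var} (A : Set E) (h : GuardSound P) (k : GuardSound Q)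
    (hf : FairSound P) (kf : FairSound Q) : GuardSound (.par A P Q) := by
  intro V hV ρ
  rw [guards] at hV
  split_ifs at hV with hPQ
  · exact Proc.tickGuarded_par_of_not_mem_div A (hf.not_mem_div hPQ.1 ρ) (kf.not_mem_div hPQ.2 ρ)
      (hV.imp (fun hV => h V hV ρ) fun hV => k V hV ρ)
  · exact (h V hV.1 ρ).par A (k V hV.2 ρ)

theorem GuardSound.hide {P : Term E Var} (h : GuardSound P) (hf : FairSound P) (A : Set E) :
    GuardSound (.hide P A) := by
  intro V hV ρ
  rw [guards] at hV
  split_ifs at hV with hP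
  · obtain ⟨V', hV', hA, hV⟩ := hV
    exact (h V' hV' ρ).hide hA hV (hf.of_isClosed hP.1 hP.2 ρ)
  · exact absurd hV (Set.notMem_empty _)

/-- `GuardSound P` covers all assignments, including the one sending `X` to the fixed point itself.
-/
theorem GuardSound.mu {P : Term E Var} (h : GuardSound P) (X : Var) : GuardSound (.mu X P) := by
  intro V hV ρ
  rw [guards] at hV
  have := h V hV (update ρ X (denote (.mu X P) ρ))
  have hfix : denote P (update ρ X (denote (.mu X P) ρ)) = denote (.mu X P) ρ :=
    OrderHom.map_lfp ⟨fun p => denote P (update ρ X p),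
      fun _ _ h => (denote P).2 (update_le_update_iff.2 ⟨h, fun _ _ => le_rfl⟩)⟩
  rwa [hfix] at this

/-- The cross-dependencies are: guards of `;`, `∥` and hiding use fairness, contractivity of `;`
uses guards, and fairness of `μ` uses contractivity. -/
theorem sound (P : Term E Var) : GuardSound P ∧ ContrSound P ∧ FairSound P := by
  induction P with
  | STOP =>
    exact ⟨fun V _ _ => Proc.tickGuarded_STOP V, fun _ _ _ _ _ _ _ _ _ => .refl _ _ _,
      fun _ V _ _ _ => Proc.isFair_STOP V⟩
  | SKIP =>
    refine ⟨fun V hV => ?_, fun _ _ _ _ _ _ _ _ _ => .refl _ _ _,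
      fun _ V _ _ _ => Proc.isFair_SKIP V⟩
    rw [guards] at hV
    exact absurd hV (Set.notMem_empty _)
  | DIV =>
    refine ⟨fun V hV => ?_, fun _ _ _ _ _ _ _ _ _ => .refl _ _ _, fun U V hUV => ?_⟩
    · rw [guards] at hV
      exact absurd hV (Set.notMem_empty _)
    · rw [fair] at hUV
      exact absurd hUV (Set.notMem_empty _)
  | pre a P ih =>
    obtain ⟨hg, hc, hf⟩ := ih
    refine ⟨fun V hV ρ => ?_, hc.pre a, fun U V hUV ρ hρ => ?_⟩
    · rw [guards] at hV
      exact Proc.tickGuarded_pre (hV.imp (fun hV => hg V hV ρ) id)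
    · rw [fair] at hUV
      exact (hf U V hUV ρ hρ).pre a
  | intChoice P Q ihP ihQ =>
    obtain ⟨hg, hc, hf⟩ := ihP
    obtain ⟨kg, kc, kf⟩ := ihQ
    refine ⟨fun V hV ρ => ?_, hc.intChoice kc, fun U V hUV ρ hρ => ?_⟩
    · rw [guards] at hV
      exact (hg V hV.1 ρ).choice (kg V hV.2 ρ)
    · rw [fair] at hUV
      exact (hf U V hUV.1 ρ fun X hX => hρ X (Or.inl hX)).choice
        (kf U V hUV.2 ρ fun X hX => hρ X (Or.inr hX))
  | extChoice P Q ihP ihQ =>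
    obtain ⟨hg, hc, hf⟩ := ihP
    obtain ⟨kg, kc, kf⟩ := ihQ
    refine ⟨fun V hV ρ => ?_, hc.extChoice kc, fun U V hUV ρ hρ => ?_⟩
    · rw [guards] at hV
      exact (hg V hV.1 ρ).choice (kg V hV.2 ρ)
    · rw [fair] at hUV
      exact (hf U V hUV.1 ρ fun X hX => hρ X (Or.inl hX)).choice
        (kf U V hUV.2 ρ fun X hX => hρ X (Or.inr hX))
  | par A P Q ihP ihQ =>
    obtain ⟨hg, hc, hf⟩ := ihP
    obtain ⟨kg, kc, kf⟩ := ihQ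
    exact ⟨hg.par A kg hf kf, hc.par A kc, hf.par A kf⟩
  | seq P Q ihP ihQ =>
    obtain ⟨hg, hc, hf⟩ := ihP
    obtain ⟨kg, kc, kf⟩ := ihQ
    refine ⟨hg.seq kg hf, hc.seq kc hg, fun U V hUV ρ hρ => ?_⟩
    rw [fair] at hUV
    exact (hf U V hUV.1 ρ fun X hX => hρ X (Or.inl hX)).seq
      (kf U V hUV.2 ρ fun X hX => hρ X (Or.inr hX))
  | hide P A ih =>
    obtain ⟨hg, hc, hf⟩ := ih
    refine ⟨hg.hide hf A, hc.hide A, fun U V hUV ρ hρ => ?_⟩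
    rw [fair] at hUV
    obtain ⟨V', hV', hA, hV⟩ := hUV
    exact (hf U V' hV' ρ hρ).hide hA hV
  | rename P R ih =>
    obtain ⟨hg, hc, hf⟩ := ih
    refine ⟨fun V hV ρ => ?_, hc.rename R, fun U V hUV ρ hρ => ?_⟩
    · rw [guards] at hV
      obtain ⟨V', hV', hV⟩ := hV
      exact (hg V' hV' ρ).rename hV
    · rw [fair] at hUV
      obtain ⟨V', hV', hV⟩ := hUV
      exact (hf U V' hV' ρ hρ).rename hV
  | var X =>
    refine ⟨fun V hV => ?_, contrSound_var X, fun U V hUV ρ hρ => ?_⟩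
    · rw [guards] at hV
      exact absurd hV (Set.notMem_empty _)
    · rw [fair] at hUV
      exact (hρ X rfl).mono hUV
  | mu X P ih =>
    obtain ⟨hg, hc, hf⟩ := ih
    exact ⟨hg.mu X, hc.mu X, hf.mu hc X⟩

end

end CSP

theorem proposition5p2 {E Var : Type*} [Finite E] [DecidableEq Var]
    (P : CSP.Term E Var) (V : Set E) (hV : V ∈ CSP.guards P) :
    (∀ ρ : Var → CSP.Proc E, (CSP.denote P ρ).TickGuarded V) ∧
    (∀ σ : Var → CSP.Term E Var, (∀ X ∈ P.fv, (σ X).IsClosed) →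
      ∀ ρ : Var → CSP.Proc E, (CSP.denote (P.subst σ) ρ).TickGuarded V) := by
  have key := (CSP.sound P).1 V hV
  refine ⟨key, fun σ hσ ρ => ?_⟩
  rw [CSP.denote_subst P σ ρ fun X hX => Or.inl (hσ X hX)]
  exact key _
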